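/- All automorphisms below are invertible bimeasurable measure-preserving maps of standard Borel probability spaces. An automorphism $S$ of $(Y,\mathcal C,\nu)$ is weakly mixing if $S\times S$ is ergodic for $\nu\otimes\nu$. A joining of automorphisms $T$ of $(X,\mathcal B,\mu)$ and $S$ of $(Y,\mathcal C,\nu)$ is a $T\times S$-invariant probability measure on $X\times Y$ with marginals $\mu$ and $\nu$; $T$ and $S$ are disjoint if $\mu\otimes\nu$ is their only joining. For $n\ge 1$, an ergodic automorphism $R$ of $(Z,\mathcal D,\rho)$ has the property JP($n$) if for every $k\ge n+1$, all weakly mixing automorphisms $S_i$ of $(Y_i,\mathcal C_i,\nu_i)$, $1\le i\le k$, and every ergodic joining $\lambda$ of $R$ with $S_1\times\dots\times S_k$ there are $i_1,\dots,i_n\in\{1,\dots,k\}$ such that $$\lambda=\lambda_{Z,Y_{i_1},\dots,Y_{i_n}}\otimes\bigotimes_{j\notin\{i_1,\dots,i_n\}}\nu_j ,$$ where $\lambda_{Z,Y_{i_1},\dots,Y_{i_n}}$ is the projection of $\lambda$ on the product of the indicated coordinates. For an automorphism $S$ of $(Y,\mathcal C,\nu)$ and $k\ge1$, let $\mathcal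 F_k(S)$ be the $\sigma$-algebra of all sets in $\mathcal C^{\otimes k}$ that are invariant under all permutations of the $k$ coordinates (the symmetric factor of $S^{\times k}$). \textbf{Proposition.} Fix $n\ge 1$ and let $T$ be an automorphism of a standard Borel probability space $(X,\mathcal B,\mu)$. Assume that for each $g\in L^2(X,\mathcal B,\mu)$ there exist a sequence of positive integers $k_j\to\infty$, a sequence of weakly mixing automorphisms $S_j$ of standard Borel probability spaces $(Y_j,\mathcal C_j,\nu_j)$, and factor maps $\pi_j\colon Y_j^{k_j}\to X$ from $S_j^{\times k_j}$ onto $T$ (that is, $\pi_j$ is measurable, sends $\nu_j^{\otimes k_j}$ to $\mu$, and $\pi_j\circ S_j^{\times k_j}=T\circ\pi_j$ almost everywhere) such that $$\operatorname{dist}\bigl(g\circ\pi_j,\;L^2(\mathcal F_{k_j}(S_j))\bigr)=o\bigl(k_j^{-n/2}\bigr)\quad\text{as } j\to\infty,$$ the distance being taken in $L^2(Y_j^{k_j},\nu_j^{\otimes k_j})$. Then $T$ is disjoint from every automorphism with the property JP($n$). (This holds with $L^2$ meaning real or complex $L^2$ throughout.) -/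

import Mathlib

open MeasureTheory Filter Asymptotics

universe u v w

namespace JoiningPrimeness

/-- `S` is a weakly mixing automorphism of the probability space `(Y, ν)`:
it preserves `ν` and `S × S` is ergodic with respect to `ν ⊗ ν`. -/
structure IsWeaklyMixing {Y : Type u} [MeasurableSpace Y] (S : Y ≃ᵐ Y) (ν : Measure Y) :
    Prop where
  measurePreserving : MeasurePreserving S ν ν
  ergodic_prod : Ergodic (Prod.map S S) (ν.prod ν)

/-- `κ` is a joining of `(X, μ, T)` and `(Y, ν, S)`. -/
structure IsJoining {X : Type u} {Y : Type v} [MeasurableSpace X] [MeasurableSpace Y]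
    (T : X → X) (μ : Measure X) (S : Y → Y) (ν : Measure Y) (κ : Measure (X × Y)) : Prop where
  map_fst : κ.map Prod.fst = μ
  map_snd : κ.map Prod.snd = ν
  invariant : MeasurePreserving (Prod.map T S) κ κ

/-- The set `J(T, S)` of all joinings. -/
def joinings {X : Type u} {Y : Type v} [MeasurableSpace X] [MeasurableSpace Y]
    (T : X → X) (μ : Measure X) (S : Y → Y) (ν : Measure Y) : Set (Measure (X × Y)) :=
  {κ | IsJoining T μ S ν κ}

/-- `T` and `S` are disjoint: the product measure is their only joining. -/
def AreDisjoint {X : Type u} {Y : Type v} [MeasurableSpace X] [MeasurableSpace Y]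
    (T : X → X) (μ : Measure X) (S : Y → Y) (ν : Measure Y) : Prop :=
  joinings T μ S ν = {μ.prod ν}

/-- For a measure `κ` on `X × ∏ i, Y i` and a set `I` of coordinates:
`κ = κ_{X, (Y i)_{i ∈ I}} ⊗ ⨂_{j ∉ I} ν j`, up to the obvious reordering of coordinates. -/
def IsIndepExtension {X : Type u} [MeasurableSpace X] {k : ℕ} {Y : Fin k → Type v}
    [∀ i, MeasurableSpace (Y i)] (ν : ∀ i, Measure (Y i)) (κ : Measure (X × (∀ i, Y i)))
    (I : Finset (Fin k)) : Prop :=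
  κ.map (fun p => ((p.1, fun i : {i // i ∈ I} => p.2 i), fun j : {j // j ∉ I} => p.2 j)) =
    (κ.map (fun p => (p.1, fun i : {i // i ∈ I} => p.2 i))).prod
      (Measure.pi fun j : {j // j ∉ I} => ν j)

/-- The joining primeness property of order `n` of an automorphism `R` of a standard probability
space `(Z, ρ)`. -/
structure JP {Z : Type v} [MeasurableSpace Z] (n : ℕ) (R : Z ≃ᵐ Z) (ρ : Measure Z) : Prop where
  ergodic : Ergodic R ρ
  exists_isIndepExtension : ∀ (k : ℕ), n + 1 ≤ k →
    ∀ (Y : Fin k → Type w) [∀ i, MeasurableSpace (Y i)] [∀ i, StandardBorelSpace (Y i)]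
      (ν : ∀ i, Measure (Y i)) [∀ i, IsProbabilityMeasure (ν i)] (S : ∀ i, Y i ≃ᵐ Y i),
      (∀ i, IsWeaklyMixing (S i) (ν i)) →
      ∀ κ : Measure (Z × (∀ i, Y i)),
        IsJoining R ρ (Pi.map fun i => S i) (Measure.pi ν) κ →
        Ergodic (Prod.map R (Pi.map fun i => S i)) κ →
        ∃ i : Fin n → Fin k, IsIndepExtension ν κ (Finset.univ.image i)

/-- `π` is a factor map from `(Y, ν, S)` onto `(X, μ, T)`. -/
structure IsFactorMap {Y : Type u} {X : Type v} [MeasurableSpace Y] [MeasurableSpace X]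
    (S : Y → Y) (ν : Measure Y) (T : X → X) (μ : Measure X) (π : Y → X) : Prop where
  measurePreserving : MeasurePreserving π ν μ
  equivariant : π ∘ S =ᵐ[ν] T ∘ π

/-- The symmetric factor: the σ-algebra of all measurable subsets of `Y ^ k` that are invariant
under all permutations of the coordinates. -/
@[reducible]
def symmetricFactor (Y : Type u) [MeasurableSpace Y] (k : ℕ) : MeasurableSpace (Fin k → Y) where
  MeasurableSet' A := MeasurableSet A ∧
    ∀ σ : Equiv.Perm (Fin k), (fun y : Fin k → Y => y ∘ σ) ⁻¹' A = A
  measurableSet_empty := ⟨MeasurableSet.empty, fun _ => rfl⟩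
  measurableSet_compl A hA :=
    ⟨hA.1.compl, fun σ => by rw [Set.preimage_compl, hA.2 σ]⟩
  measurableSet_iUnion f hf :=
    ⟨MeasurableSet.iUnion fun i => (hf i).1, fun σ => by
      rw [Set.preimage_iUnion]; exact Set.iUnion_congr fun i => (hf i).2 σ⟩

/-- The `L²`-distance from `G ∈ L²(Y ^ k, ν^{⊗ k})` to the subspace of (classes of) functions that
are measurable with respect to the symmetric factor. -/
noncomputable def distSymmetric {𝕜 : Type*} [RCLike 𝕜] {Y : Type u} [MeasurableSpace Y] {k : ℕ}
    {ν : Measure Y} (G : Lp 𝕜 2 (Measure.pi fun _ : Fin k => ν)) : ℝ :=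
  Metric.infDist G
    (lpMeas 𝕜 𝕜 (symmetricFactor Y k) 2 (Measure.pi fun _ : Fin k => ν) : Set _)

end JoiningPrimeness

open JoiningPrimeness

/-! Let κ be a joining of `T` with an automorphism `R` having JP(n), and suppose `T` is a factor of
`S^k` through `π`. Gluing κ to `S^k` relatively independently over `X` gives a joining `l` of `R`
with `S^k` (`IsJoining.exists_lift`). Both `R` and `S^k` are ergodic, so almost every ergodic
component of `l` is again a joining of the two, and JP(n) applies to it: in each component, `Z`
interacts with at most `n` of the `k` coordinates, although which ones may vary with the component.

A symmetric function cannot single out a few coordinates. If `F` is symmetric and `h` depends on `n`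
coordinates, `F` has the same correlation with each of `m` independent copies of `h` placed on
disjoint blocks, where `m * n ≤ k`. Their sum has standard deviation of order at most √m, so the
covariance of `F` and `h`, with values in [0,1], is at most 1/√m
(`abs_integral_mul_sub_le_of_symmetric`).

If the lift of the indicator of `B` lies within ε of the symmetric factor, every component therefore
gives `A × π⁻¹B` the product mass up to 2ε + 1/√m. Averaging over components bounds the defect of κ
on `B × A` in the same way (`JP.abs_measureReal_joining_sub_le`). The approximation hypothesis for
the indicator of `B` lets ε tend to 0 and `m` to infinity.

The ergodic theory behind this is derived from the mean ergodic theorem: ergodicity of products of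
weakly mixing maps, and the ergodic decomposition, realised by conditional measures given the
invariant σ-algebra. -/

open ProbabilityTheory
open scoped Topology

/-! ### Mean ergodic theorem and criteria for ergodicity. -/

section MeanErgodic

variable {Ω : Type*} [MeasurableSpace Ω] {μ : Measure Ω} {f : Ω → Ω}

/-- The von Neumann mean ergodic theorem for the Koopman operator, in terms of functions. -/
theorem exists_tendsto_eLpNorm_birkhoffAverage
    (hf : MeasurePreserving f μ μ) {u : Ω → ℝ} (hu : MemLp u 2 μ) :
    ∃ P : Ω → ℝ, MemLp P 2 μ ∧ P ∘ f =ᵐ[μ] P ∧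
      Tendsto (fun N => eLpNorm (birkhoffAverage ℝ f u N - P) 2 μ) atTop (𝓝 0) := by
  set U : Lp ℝ 2 μ →L[ℝ] Lp ℝ 2 μ := (Lp.compMeasurePreservingₗᵢ ℝ f hf).toContinuousLinearMap
  have hU : ‖U‖ ≤ 1 := LinearIsometry.norm_toContinuousLinearMap_le _
  have hlim := U.tendsto_birkhoffAverage_orthogonalProjection hU (hu.toLp u)
  set P := (U.eqLocus (1 : Lp ℝ 2 μ →L[ℝ] Lp ℝ 2 μ)).orthogonalProjectionOnto (hu.toLp u) with hP
  have hUiter : ∀ n : ℕ, ((U^[n] (hu.toLp u) : Lp ℝ 2 μ) : Ω → ℝ) =ᵐ[μ] u ∘ f^[n] := by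
    intro n
    induction n with
    | zero => exact hu.coeFn_toLp
    | succ n ih =>
      rw [Function.iterate_succ_apply']
      refine (Lp.coeFn_compMeasurePreserving _ hf).trans ?_
      rw [Function.iterate_succ, ← Function.comp_assoc]
      exact hf.quasiMeasurePreserving.ae_eq_comp ih
  refine ⟨(P : Lp ℝ 2 μ), Lp.memLp _, ?_, ?_⟩
  · have h1 : U (P : Lp ℝ 2 μ) = P := P.2
    have h2 := Lp.coeFn_compMeasurePreserving (P : Lp ℝ 2 μ) hf
    have h3 : Lp.compMeasurePreserving f hf (P : Lp ℝ 2 μ) = P := h1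
    rw [h3] at h2
    exact h2.symm
  · rw [Lp.tendsto_Lp_iff_tendsto_eLpNorm'] at hlim
    refine hlim.congr fun N => eLpNorm_congr_ae ?_
    refine EventuallyEq.sub ?_ EventuallyEq.rfl
    have hall : ∀ᵐ x ∂μ, ∀ n, (U^[n] (hu.toLp u) : Lp ℝ 2 μ) x = u (f^[n] x) :=
      ae_all_iff.2 hUiter
    have hsum : ((∑ n ∈ Finset.range N, U^[n] (hu.toLp u) : Lp ℝ 2 μ) : Ω → ℝ) =ᵐ[μ]
        fun x => ∑ n ∈ Finset.range N, u (f^[n] x) := by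
      refine (Lp.coeFn_fun_finsetSum _ _).trans ?_
      filter_upwards [hall] with x hx
      exact Finset.sum_congr rfl fun n _ => hx n
    refine (Lp.coeFn_smul _ _).trans ?_
    filter_upwards [hsum] with x hx
    simp only [Pi.smul_apply, birkhoffAverage, birkhoffSum, id] at hx ⊢
    rw [hx]

theorem memLp_birkhoffAverage (hf : MeasurePreserving f μ μ) {u : Ω → ℝ}
    {p : ENNReal} (hu : MemLp u p μ) (N : ℕ) : MemLp (birkhoffAverage ℝ f u N) p μ := by
  have : birkhoffAverage ℝ f u N = (N : ℝ)⁻¹ • ∑ n ∈ Finset.range N, u ∘ f^[n] := by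
    ext x; simp [birkhoffAverage, birkhoffSum]
  rw [this]
  have hsum : MemLp (∑ n ∈ Finset.range N, u ∘ f^[n]) p μ :=
    memLp_finsetSum' _ fun n _ => hu.comp_measurePreserving (hf.iterate n)
  exact hsum.const_smul (N : ℝ)⁻¹

theorem tendsto_setIntegral_birkhoffAverage [IsProbabilityMeasure μ]
    (hf : MeasurePreserving f μ μ) {u P : Ω → ℝ} (hu : MemLp u 2 μ) (hP : MemLp P 2 μ)
    (h : Tendsto (fun N => eLpNorm (birkhoffAverage ℝ f u N - P) 2 μ) atTop (𝓝 0))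
    (B : Set Ω) :
    Tendsto (fun N => ∫ x in B, birkhoffAverage ℝ f u N x ∂μ) atTop (𝓝 (∫ x in B, P x ∂μ)) := by
  refine tendsto_setIntegral_of_L1' P (hP.integrable one_le_two).aestronglyMeasurable
    (Eventually.of_forall fun N => (memLp_birkhoffAverage hf hu N).integrable one_le_two) ?_ B
  refine tendsto_of_tendsto_of_tendsto_of_le_of_le tendsto_const_nhds h (fun _ => zero_le) ?_
  intro N
  exact eLpNorm_le_eLpNorm_of_exponent_le one_le_two
    ((memLp_birkhoffAverage hf hu N).sub hP).aestronglyMeasurable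

theorem setIntegral_birkhoffAverage_indicator [IsFiniteMeasure μ]
    (hf : MeasurePreserving f μ μ) {A : Set Ω} (hA : MeasurableSet A) (B : Set Ω) (N : ℕ) :
    ∫ x in B, birkhoffAverage ℝ f (A.indicator 1) N x ∂μ =
      (N : ℝ)⁻¹ * ∑ n ∈ Finset.range N, μ.real (f^[n] ⁻¹' A ∩ B) := by
  simp only [birkhoffAverage, birkhoffSum, smul_eq_mul]
  rw [integral_const_mul, integral_finsetSum]
  · congr 1
    refine Finset.sum_congr rfl fun n _ => ?_
    have hm : MeasurableSet (f^[n] ⁻¹' A) := (hf.iterate n).measurable hA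
    have : ∀ x, A.indicator (1 : Ω → ℝ) (f^[n] x) = (f^[n] ⁻¹' A).indicator 1 x := fun x => rfl
    simp_rw [this]
    rw [integral_indicator_one hm, measureReal_restrict_apply hm]
  · intro n _
    have hm : MeasurableSet (f^[n] ⁻¹' A) := (hf.iterate n).measurable hA
    exact (integrable_indicator_iff hm).2 (integrable_const (1 : ℝ)).integrableOn

theorem memLp_indicator_one [IsFiniteMeasure μ] {A : Set Ω} (hA : MeasurableSet A)
    (p : ENNReal) : MemLp (A.indicator (1 : Ω → ℝ)) p μ :=
  memLp_indicator_const p hA 1 (Or.inr (measure_ne_top _ _))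

theorem setIntegral_birkhoffAverage_of_invariant [IsFiniteMeasure μ] (hf : MeasurePreserving f μ μ)
    {A D : Set Ω} (hA : MeasurableSet A) (hD : MeasurableSet D) (hfD : f ⁻¹' D = D)
    {N : ℕ} (hN : N ≠ 0) :
    ∫ x in D, birkhoffAverage ℝ f (A.indicator 1) N x ∂μ = μ.real (A ∩ D) := by
  rw [setIntegral_birkhoffAverage_indicator hf hA]
  have hiter : ∀ n, f^[n] ⁻¹' D = D := fun n => by
    induction n with
    | zero => rfl
    | succ n ih => rw [Function.iterate_succ, Set.preimage_comp, ih, hfD]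
  have : ∀ n, μ.real (f^[n] ⁻¹' A ∩ D) = μ.real (A ∩ D) := fun n => by
    conv_lhs => rw [← hiter n, ← Set.preimage_inter]
    exact (hf.iterate n).measureReal_preimage (hA.inter hD).nullMeasurableSet
  simp only [this, Finset.sum_const, Finset.card_range, nsmul_eq_mul]
  field_simp

/-- A set which is independent of all sets of a generating π-system is trivial. -/
theorem eventuallyConst_of_measureReal_inter_eq_mul {Ω : Type*} [mΩ : MeasurableSpace Ω]
    {μ : Measure Ω} [IsProbabilityMeasure μ] {C : Set (Set Ω)}
    (hgen : mΩ = MeasurableSpace.generateFrom C) (hpi : IsPiSystem C) {D : Set Ω}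
    (hD : MeasurableSet D) (key : ∀ A ∈ C, μ.real (A ∩ D) = μ.real A * μ.real D) :
    EventuallyConst D (ae μ) := by
  have hCm : ∀ A ∈ C, MeasurableSet A := fun A hA =>
    hgen ▸ MeasurableSpace.measurableSet_generateFrom hA
  have heq : μ.restrict D = μ D • μ := by
    refine ext_of_generate_finite C hgen hpi (fun A hA => ?_) (by simp)
    rw [Measure.restrict_apply (hCm A hA), Measure.smul_apply, smul_eq_mul,
      ← ENNReal.toReal_eq_toReal_iff' (measure_ne_top _ _)
        (ENNReal.mul_ne_top (measure_ne_top _ _) (measure_ne_top _ _)), ENNReal.toReal_mul]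
    rw [mul_comm]; exact key A hA
  -- The restriction to `D` gives no mass to the complement of `D`, while the multiple of μ gives it
  -- this product.
  have h0 : μ D * μ Dᶜ = 0 := by
    have := congrArg (fun m : Measure Ω => m Dᶜ) heq
    simpa [Measure.restrict_apply hD.compl] using this.symm
  rw [eventuallyConst_set']
  rcases mul_eq_zero.1 h0 with h0 | h0
  · exact Or.inl (ae_eq_empty.2 h0)
  · exact Or.inr (ae_eq_univ.2 h0)

/-- An invariant measure is ergodic as soon as Cesàro averages of correlations of sets of a
generating π-system decouple. -/
theorem ergodic_of_tendsto_cesaro {Ω : Type*} [mΩ : MeasurableSpace Ω] {μ : Measure Ω}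
    {f : Ω → Ω} [IsProbabilityMeasure μ]
    (hf : MeasurePreserving f μ μ) {C : Set (Set Ω)} (hgen : mΩ = MeasurableSpace.generateFrom C)
    (hpi : IsPiSystem C)
    (h : ∀ A ∈ C, ∀ B ∈ C, Tendsto (fun N : ℕ => (N : ℝ)⁻¹ *
      ∑ n ∈ Finset.range N, μ.real (f^[n] ⁻¹' A ∩ B)) atTop (𝓝 (μ.real A * μ.real B))) :
    Ergodic f μ := by
  refine ⟨hf, ⟨fun D hD hfD => ?_⟩⟩
  have hCm : ∀ A ∈ C, MeasurableSet A := fun A hA =>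
    hgen ▸ MeasurableSpace.measurableSet_generateFrom hA
  have key : ∀ A ∈ C, μ.real (A ∩ D) = μ.real A * μ.real D := by
    intro A hA
    have hAm := hCm A hA
    have hu := memLp_indicator_one (μ := μ) hAm 2
    obtain ⟨P, hP, -, hlim⟩ :=
      exists_tendsto_eLpNorm_birkhoffAverage hf hu
    have hPi : Integrable P μ := hP.integrable one_le_two
    have hconv := tendsto_setIntegral_birkhoffAverage hf hu hP hlim
    have huniv : ∫ x, P x ∂μ = μ.real A := by
      have h1 := hconv Set.univ
      rw [setIntegral_univ] at h1
      refine tendsto_nhds_unique h1 (tendsto_const_nhds.congr' ?_)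
      filter_upwards [eventually_ne_atTop 0] with N hN
      rw [setIntegral_birkhoffAverage_of_invariant hf hAm MeasurableSet.univ rfl hN,
        Set.inter_univ]
    -- The limit `P` integrates like the constant μ(A): the hypothesis gives this on `C`, and a
    -- Dynkin class argument on all measurable sets. On the invariant set `D` every Birkhoff average
    -- has integral μ(A ∩ D), which yields independence of `A` and `D`.
    have hall : ∀ B, MeasurableSet B → ∫ x in B, P x ∂μ = μ.real A * μ.real B := by
      intro B hB
      induction B, hB using MeasurableSpace.induction_on_inter hgen hpi with
      | empty => simp
      | basic B hB =>
        refine tendsto_nhds_unique (hconv B) ?_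
        simpa only [setIntegral_birkhoffAverage_indicator hf hAm] using h A hA B hB
      | compl B hB ih =>
        rw [setIntegral_compl hB hPi, ih, huniv, probReal_compl_eq_one_sub hB]; ring
      | iUnion g hd hg ih =>
        have h1 := hasSum_integral_iUnion (f := P) hg hd hPi.integrableOn
        simp_rw [ih] at h1
        have h2 : HasSum (fun i => μ.real (g i)) (μ.real (⋃ i, g i)) := by
          simpa using hasSum_integral_iUnion (f := fun _ => (1 : ℝ)) hg hd
            (integrable_const (μ := μ) (1 : ℝ)).integrableOn
        exact h1.unique (h2.mul_left _)
    rw [← hall D hD]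
    refine tendsto_nhds_unique (tendsto_const_nhds.congr' ?_) (hconv D)
    filter_upwards [eventually_ne_atTop 0] with N hN
    exact (setIntegral_birkhoffAverage_of_invariant hf hAm hD hfD hN).symm
  exact eventuallyConst_of_measureReal_inter_eq_mul hgen hpi hD key

end MeanErgodic

/-! ### Products of weakly mixing automorphisms. -/

section WeakMixing

/-- The mean ergodic limit of the indicator of `A` is invariant, hence constant, and integrating
over the whole space identifies the constant. -/
theorem Ergodic.tendsto_cesaro_measureReal {Ω : Type*} [MeasurableSpace Ω] {μ : Measure Ω}
    [IsProbabilityMeasure μ] {f : Ω → Ω} (hf : Ergodic f μ) {A B : Set Ω}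
    (hA : MeasurableSet A) :
    Tendsto (fun N : ℕ => (N : ℝ)⁻¹ * ∑ n ∈ Finset.range N, μ.real (f^[n] ⁻¹' A ∩ B)) atTop
      (𝓝 (μ.real A * μ.real B)) := by
  have hfm := hf.toMeasurePreserving
  have hu := memLp_indicator_one (μ := μ) hA 2
  obtain ⟨P, hP, hinv, hlim⟩ := exists_tendsto_eLpNorm_birkhoffAverage hfm hu
  obtain ⟨c, hc⟩ := hf.ae_eq_const_of_ae_eq_comp_ae hP.aestronglyMeasurable hinv
  have hconv := tendsto_setIntegral_birkhoffAverage hfm hu hP hlim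
  have hint : ∀ B, ∫ x in B, P x ∂μ = c * μ.real B := fun B => by
    rw [integral_congr_ae (ae_restrict_of_ae hc)]
    simp [mul_comm]
  have hcA : c = μ.real A := by
    have h1 := hconv Set.univ
    rw [hint, probReal_univ, mul_one] at h1
    refine tendsto_nhds_unique h1 (tendsto_const_nhds.congr' ?_)
    filter_upwards [eventually_ne_atTop 0] with N hN
    rw [setIntegral_birkhoffAverage_of_invariant hfm hA MeasurableSet.univ rfl hN, Set.inter_univ]
  rw [← hcA, ← hint]
  simpa only [setIntegral_birkhoffAverage_indicator hfm hA] using hconv B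

/-- Expanding the square shows that the mean square deviation from `a` tends to 0; Cauchy–Schwarz
passes to the mean absolute deviation. Absolute convergence is what survives taking products of
several correlation sequences. -/
theorem tendsto_cesaro_abs_sub {x : ℕ → ℝ} {a : ℝ}
    (h1 : Tendsto (fun N : ℕ => (N : ℝ)⁻¹ * ∑ n ∈ Finset.range N, x n) atTop (𝓝 a))
    (h2 : Tendsto (fun N : ℕ => (N : ℝ)⁻¹ * ∑ n ∈ Finset.range N, x n ^ 2) atTop (𝓝 (a ^ 2))) :
    Tendsto (fun N : ℕ => (N : ℝ)⁻¹ * ∑ n ∈ Finset.range N, |x n - a|) atTop (𝓝 0) := by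
  have hsq : Tendsto (fun N : ℕ => (N : ℝ)⁻¹ * ∑ n ∈ Finset.range N, (x n - a) ^ 2) atTop
      (𝓝 0) := by
    have h3 := (h2.sub (h1.const_mul (2 * a))).add_const (a ^ 2)
    have h4 : a ^ 2 - 2 * a * a + a ^ 2 = 0 := by ring
    rw [h4] at h3
    refine h3.congr' ?_
    filter_upwards [eventually_ne_atTop 0] with N hN
    have h5 : ∑ n ∈ Finset.range N, (x n - a) ^ 2 =
        ∑ n ∈ Finset.range N, x n ^ 2 - 2 * a * ∑ n ∈ Finset.range N, x n + N * a ^ 2 := by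
      rw [Finset.mul_sum, ← Finset.sum_sub_distrib]
      have : (N : ℝ) * a ^ 2 = ∑ n ∈ Finset.range N, a ^ 2 := by simp
      rw [this, ← Finset.sum_add_distrib]
      exact Finset.sum_congr rfl fun n _ => by ring
    rw [h5]
    field_simp
  have hsqrt := (Real.continuous_sqrt.tendsto 0).comp hsq
  rw [Real.sqrt_zero] at hsqrt
  refine squeeze_zero (fun N => by positivity) (fun N => ?_) hsqrt
  refine Real.le_sqrt_of_sq_le ?_
  rcases Nat.eq_zero_or_pos N with rfl | hN
  · simp
  have hcs := sq_sum_le_card_mul_sum_sq (s := Finset.range N) (f := fun n => |x n - a|)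
  simp only [Finset.card_range, sq_abs] at hcs
  have hN' : (0 : ℝ) < N := by exact_mod_cast hN
  calc ((N : ℝ)⁻¹ * ∑ n ∈ Finset.range N, |x n - a|) ^ 2
      = (N : ℝ)⁻¹ ^ 2 * (∑ n ∈ Finset.range N, |x n - a|) ^ 2 := by ring
    _ ≤ (N : ℝ)⁻¹ ^ 2 * (N * ∑ n ∈ Finset.range N, (x n - a) ^ 2) := by gcongr
    _ = _ := by field_simp

theorem abs_prod_sub_prod_le {ι : Type*} (s : Finset ι) {x y : ι → ℝ}
    (hx : ∀ i, x i ∈ Set.Icc (0 : ℝ) 1) (hy : ∀ i, y i ∈ Set.Icc (0 : ℝ) 1) :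
    |∏ i ∈ s, x i - ∏ i ∈ s, y i| ≤ ∑ i ∈ s, |x i - y i| := by
  classical
  induction s using Finset.induction_on with
  | empty => simp
  | insert i s hi ih =>
    rw [Finset.prod_insert hi, Finset.prod_insert hi, Finset.sum_insert hi]
    have h1 : |∏ j ∈ s, x j| ≤ 1 := by
      rw [Finset.abs_prod]
      exact Finset.prod_le_one (fun _ _ => abs_nonneg _) fun j _ => by
        rw [abs_of_nonneg (hx j).1]; exact (hx j).2
    have h2 : |y i| ≤ 1 := by rw [abs_of_nonneg (hy i).1]; exact (hy i).2
    calc |x i * ∏ j ∈ s, x j - y i * ∏ j ∈ s, y j|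
        = |(x i - y i) * ∏ j ∈ s, x j + y i * (∏ j ∈ s, x j - ∏ j ∈ s, y j)| := by ring_nf
      _ ≤ |x i - y i| * |∏ j ∈ s, x j| + |y i| * |∏ j ∈ s, x j - ∏ j ∈ s, y j| := by
          rw [← abs_mul, ← abs_mul]; exact abs_add_le _ _
      _ ≤ |x i - y i| * 1 + 1 * ∑ j ∈ s, |x j - y j| := by gcongr
      _ = _ := by ring

namespace JoiningPrimeness

theorem IsWeaklyMixing.ergodic {Y : Type*} [MeasurableSpace Y] {S : Y ≃ᵐ Y} {ν : Measure Y}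
    [IsProbabilityMeasure ν] (h : IsWeaklyMixing S ν) : Ergodic S ν :=
  measurePreserving_fst.ergodic_of_ergodic_semiconj h.ergodic_prod
    S.measurable fun _ => rfl

/-- The square of a correlation of `A` and `B` under `S` is the correlation of `A × A` and `B × B`
under `S × S`, so ergodicity of the latter supplies the second moment. -/
theorem IsWeaklyMixing.tendsto_cesaro_abs {Y : Type*} [MeasurableSpace Y] {S : Y ≃ᵐ Y}
    {ν : Measure Y} [IsProbabilityMeasure ν] (h : IsWeaklyMixing S ν) {A B : Set Y}
    (hA : MeasurableSet A) :
    Tendsto (fun N : ℕ => (N : ℝ)⁻¹ * ∑ n ∈ Finset.range N,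
      |ν.real (S^[n] ⁻¹' A ∩ B) - ν.real A * ν.real B|) atTop (𝓝 0) := by
  refine tendsto_cesaro_abs_sub (h.ergodic.tendsto_cesaro_measureReal hA) ?_
  have h2 := h.ergodic_prod.tendsto_cesaro_measureReal (A := A ×ˢ A) (B := B ×ˢ B) (hA.prod hA)
  have hprod : ∀ C : Set Y, (ν.prod ν).real (C ×ˢ C) = ν.real C ^ 2 := fun C => by
    rw [measureReal_prod_prod, sq]
  have h3 : ∀ n, (Prod.map S S)^[n] ⁻¹' (A ×ˢ A) ∩ B ×ˢ B =
      (S^[n] ⁻¹' A ∩ B) ×ˢ (S^[n] ⁻¹' A ∩ B) := fun n => by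
    rw [Prod.map_iterate, ← Set.prod_inter_prod]; rfl
  simp only [h3, hprod] at h2
  rwa [mul_pow]

/-- A finite product of weakly mixing automorphisms is ergodic. -/
theorem ergodic_pi_of_isWeaklyMixing {ι : Type*} [Fintype ι] {Y : ι → Type*}
    [∀ i, MeasurableSpace (Y i)] {ν : ∀ i, Measure (Y i)} [∀ i, IsProbabilityMeasure (ν i)]
    {S : ∀ i, Y i ≃ᵐ Y i} (h : ∀ i, IsWeaklyMixing (S i) (ν i)) :
    Ergodic (Pi.map fun i => S i) (Measure.pi ν) := by
  have hmp : MeasurePreserving (Pi.map fun i => S i) (Measure.pi ν) (Measure.pi ν) :=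
    measurePreserving_pi ν ν fun i => (h i).measurePreserving
  refine ergodic_of_tendsto_cesaro hmp generateFrom_pi.symm isPiSystem_pi ?_
  rintro _ ⟨A, hA, rfl⟩ _ ⟨B, hB, rfl⟩
  simp only [Set.mem_pi, Set.mem_univ, forall_true_left, Set.mem_ofPred_eq] at hA hB
  have hpi : ∀ t : ∀ i, Set (Y i), (Measure.pi ν).real (Set.univ.pi t) = ∏ i, (ν i).real (t i) :=
    fun t => by
      simp only [Measure.real, Measure.pi_pi, ENNReal.toReal_prod]
  have hpre : ∀ n, (Pi.map fun i => S i)^[n] ⁻¹' (Set.univ.pi A) ∩ Set.univ.pi B =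
      Set.univ.pi fun i => (S i)^[n] ⁻¹' A i ∩ B i := fun n => by
    rw [Pi.map_iterate, Set.pi_inter_distrib]; rfl
  simp only [hpre, hpi]
  rw [← Finset.prod_mul_distrib, tendsto_iff_dist_tendsto_zero]
  have hsum : Tendsto (fun N : ℕ => ∑ i, (N : ℝ)⁻¹ * ∑ n ∈ Finset.range N,
      |(ν i).real ((S i)^[n] ⁻¹' A i ∩ B i) - (ν i).real (A i) * (ν i).real (B i)|) atTop
      (𝓝 (∑ _i : ι, 0)) :=
    tendsto_finsetSum _ fun i _ => (h i).tendsto_cesaro_abs (hA i)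
  rw [Finset.sum_const_zero] at hsum
  refine squeeze_zero' (Eventually.of_forall fun _ => dist_nonneg) ?_ hsum
  filter_upwards [eventually_ne_atTop 0] with N hN
  have hN' : (N : ℝ) ≠ 0 := by exact_mod_cast hN
  set q := ∏ i, (ν i).real (A i) * (ν i).real (B i)
  -- Writing the limit as its own average reduces the estimate to a termwise comparison of two
  -- products with factors in [0,1].
  have hq : q = (N : ℝ)⁻¹ * ∑ n ∈ Finset.range N, q := by
    simp [hN']
  conv_lhs => rw [hq]
  rw [Real.dist_eq, ← mul_sub, ← Finset.sum_sub_distrib, abs_mul, abs_of_nonneg (by positivity),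
    ← Finset.mul_sum, Finset.sum_comm]
  gcongr
  refine (Finset.abs_sum_le_sum_abs _ _).trans (Finset.sum_le_sum fun n _ => ?_)
  exact abs_prod_sub_prod_le _ (fun i => ⟨measureReal_nonneg, measureReal_le_one⟩)
    (fun i => ⟨by positivity, mul_le_one₀ measureReal_le_one measureReal_nonneg
      measureReal_le_one⟩)

end JoiningPrimeness

end WeakMixing

/-! ### Ergodic decomposition through conditional measures. -/

section ErgodicDecomposition

/-- Countability allows almost sure statements about single sets to hold simultaneously off one null
set. -/
theorem exists_countable_isPiSystem_generateFrom (Ω : Type*) [mΩ : MeasurableSpace Ω]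
    [MeasurableSpace.CountablyGenerated Ω] :
    ∃ C : Set (Set Ω), C.Countable ∧ IsPiSystem C ∧ mΩ = MeasurableSpace.generateFrom C := by
  refine ⟨generateSetAlgebra (MeasurableSpace.countableGeneratingSet Ω),
    countable_generateSetAlgebra MeasurableSpace.countable_countableGeneratingSet, ?_, ?_⟩
  · intro s hs t ht _
    exact isSetAlgebra_generateSetAlgebra.inter_mem hs ht
  · rw [generateFrom_generateSetAlgebra_eq,
      MeasurableSpace.generateFrom_countableGeneratingSet]

variable {Ω : Type*} {m : MeasurableSpace Ω} [mΩ : MeasurableSpace Ω] [StandardBorelSpace Ω]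
  {μ : Measure Ω}

theorem ae_ae_condExpKernel [IsFiniteMeasure μ] (hm : m ≤ mΩ) {p : Ω → Prop}
    (hp : ∀ᵐ x ∂μ, p x) : ∀ᵐ ω ∂μ, ∀ᵐ x ∂condExpKernel μ m ω, p x := by
  rw [← condExpKernel_comp_trim (μ := μ) hm] at hp
  exact ae_of_ae_trim hm (Measure.ae_ae_of_ae_comp hp)

theorem ae_ae_condExpKernel_eq [IsFiniteMeasure μ] (hm : m ≤ mΩ) {g : Ω → ℝ}
    (hg : Measurable[m] g) : ∀ᵐ ω ∂μ, ∀ᵐ x ∂condExpKernel μ m ω, g x = g ω := by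
  refine ae_of_ae_trim hm (Measure.ae_ae_of_ae_compProd (p := fun q => g q.2 = g q.1) ?_)
  -- The measure on pairs is the image of μ under the diagonal, where the two values of `g` agree
  -- trivially. The first coordinate carries only `m`, which is why `g` must be `m`-measurable.
  rw [compProd_trim_condExpKernel hm]
  have hset : MeasurableSet[m.prod mΩ] {q : Ω × Ω | g q.2 = g q.1} :=
    @measurableSet_eq_fun _ _ (m.prod mΩ) _ _ _ _
      ((hg.mono hm le_rfl).comp (@measurable_snd _ _ m mΩ))
      (hg.comp (@measurable_fst _ _ m mΩ))
  have hdiag : @Measurable Ω (Ω × Ω) mΩ (m.prod mΩ) Function.diag :=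
    @Measurable.prodMk _ mΩ _ _ m mΩ _ _ (measurable_id'' hm) measurable_id
  refine (@ae_map_iff _ _ mΩ (m.prod mΩ) _ _
    (@Measurable.aemeasurable _ _ mΩ (m.prod mΩ) _ _ hdiag) _ hset).2 ?_
  exact ae_of_all _ fun _ => rfl

theorem condExpKernel_real_ae_eq [IsFiniteMeasure μ] (hm : m ≤ mΩ) {A : Set Ω}
    (hA : MeasurableSet A) {g : Ω → ℝ} (hg : Integrable g μ) (hgm : StronglyMeasurable[m] g)
    (h : ∀ D, MeasurableSet[m] D → ∫ x in D, g x ∂μ = μ.real (A ∩ D)) :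
    ∀ᵐ ω ∂μ, (condExpKernel μ m ω).real A = g ω := by
  have h1 := condExpKernel_ae_eq_condExp (μ := μ) hm hA
  have h2 : g =ᵐ[μ] μ[A.indicator (fun _ => (1 : ℝ)) | m] := by
    refine ae_eq_condExp_of_forall_setIntegral_eq hm ((integrable_const 1).indicator hA)
      (fun _ _ _ => hg.integrableOn) (fun D hD _ => ?_) hgm.aestronglyMeasurable
    rw [h D hD, integral_indicator hA]
    simp [measureReal_restrict_apply hA]
  exact h1.trans h2.symm

theorem setIntegral_condExpKernel_real [IsFiniteMeasure μ] (hm : m ≤ mΩ) {A : Set Ω}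
    (hA : MeasurableSet A) {D : Set Ω} (hD : MeasurableSet[m] D) :
    ∫ ω in D, (condExpKernel μ m ω).real A ∂μ = μ.real (A ∩ D) := by
  rw [setIntegral_congr_ae (g := μ[A.indicator (fun _ => (1 : ℝ)) | m]) (hm _ hD),
    setIntegral_condExp hm ((integrable_const 1).indicator hA) hD, integral_indicator hA]
  · simp [measureReal_restrict_apply hA]
  · filter_upwards [condExpKernel_ae_eq_condExp (μ := μ) hm hA] with x hx _ using hx

theorem integral_condExpKernel_real [IsFiniteMeasure μ] (hm : m ≤ mΩ) {A : Set Ω}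
    (hA : MeasurableSet A) : ∫ ω, (condExpKernel μ m ω).real A ∂μ = μ.real A := by
  simpa using setIntegral_condExpKernel_real (μ := μ) hm hA MeasurableSet.univ

variable {f : Ω → Ω}

/-- Invariance of μ gives `A` and `f⁻¹A` the same mass in every invariant set, so their conditional
probabilities agree almost surely; a countable π-system suffices. -/
theorem ae_measurePreserving_condExpKernel_invariants [IsProbabilityMeasure μ]
    (hf : MeasurePreserving f μ μ) :
    ∀ᵐ ω ∂μ, MeasurePreserving f (condExpKernel μ (MeasurableSpace.invariants f) ω)
      (condExpKernel μ (MeasurableSpace.invariants f) ω) := by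
  obtain ⟨C, hCc, hCpi, hCgen⟩ := exists_countable_isPiSystem_generateFrom Ω
  have hm : MeasurableSpace.invariants f ≤ mΩ := MeasurableSpace.invariants_le f
  have hCm : ∀ A ∈ C, MeasurableSet A := fun A hA =>
    hCgen ▸ MeasurableSpace.measurableSet_generateFrom hA
  have key : ∀ᵐ ω ∂μ, ∀ A ∈ C,
      (condExpKernel μ (MeasurableSpace.invariants f) ω).real (f ⁻¹' A) =
        (condExpKernel μ (MeasurableSpace.invariants f) ω).real A := by
    refine (ae_ball_iff hCc).2 fun A hA => ?_
    have hAm := hCm A hA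
    refine condExpKernel_real_ae_eq hm (hf.measurable hAm)
      (integrable_toReal_condExpKernel hAm) ?_ fun D hD => ?_
    · exact (measurable_condExpKernel hAm).ennreal_toReal.stronglyMeasurable
    · rw [setIntegral_condExpKernel_real hm hAm hD]
      obtain ⟨hD1, hD2⟩ := MeasurableSpace.measurableSet_invariants.1 hD
      conv_rhs => rw [← hD2, ← Set.preimage_inter]
      exact (hf.measureReal_preimage (hAm.inter hD1).nullMeasurableSet).symm
  filter_upwards [key] with ω hω
  refine ⟨hf.measurable, ?_⟩
  have : IsProbabilityMeasure ((condExpKernel μ (MeasurableSpace.invariants f) ω).map f) :=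
    Measure.isProbabilityMeasure_map hf.measurable.aemeasurable
  refine ext_of_generate_finite C hCgen hCpi (fun A hA => ?_) (by simp)
  rw [Measure.map_apply hf.measurable (hCm A hA)]
  exact (ENNReal.toReal_eq_toReal_iff' (measure_ne_top _ _) (measure_ne_top _ _)).1 (hω A hA)

theorem birkhoffAverage_indicator_mem_Icc {Ω : Type*} (f : Ω → Ω) (A : Set Ω) (N : ℕ) (x : Ω) :
    birkhoffAverage ℝ f (A.indicator 1) N x ∈ Set.Icc (0 : ℝ) 1 := by
  have h0 : ∀ y, A.indicator (1 : Ω → ℝ) y ∈ Set.Icc (0 : ℝ) 1 := fun y => by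
    by_cases hy : y ∈ A <;> simp [hy]
  simp only [birkhoffAverage, birkhoffSum, smul_eq_mul]
  have h1 : ∑ n ∈ Finset.range N, A.indicator (1 : Ω → ℝ) (f^[n] x) ≤ N := by
    simpa using Finset.sum_le_sum (s := Finset.range N) fun n _ => (h0 (f^[n] x)).2
  refine ⟨mul_nonneg (by positivity) (Finset.sum_nonneg fun n _ => (h0 _).1), ?_⟩
  rcases Nat.eq_zero_or_pos N with rfl | hN
  · simp
  · have : (0 : ℝ) < N := by exact_mod_cast hN
    calc (N : ℝ)⁻¹ * ∑ n ∈ Finset.range N, A.indicator (1 : Ω → ℝ) (f^[n] x)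
        ≤ (N : ℝ)⁻¹ * N := by gcongr
      _ = 1 := inv_mul_cancel₀ (ne_of_gt this)

/-- A subsequence of the Birkhoff averages of an indicator converges almost everywhere to an
invariant function. -/
theorem exists_tendsto_birkhoffAverage_invariants {Ω : Type*} [MeasurableSpace Ω] {μ : Measure Ω}
    {f : Ω → Ω} [IsProbabilityMeasure μ] (hf : MeasurePreserving f μ μ)
    {A : Set Ω} (hA : MeasurableSet A) :
    ∃ (ns : ℕ → ℕ) (g : Ω → ℝ), StrictMono ns ∧ Measurable[MeasurableSpace.invariants f] g ∧
      ∀ᵐ x ∂μ, Tendsto (fun i => birkhoffAverage ℝ f (A.indicator 1) (ns i) x) atTop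
        (𝓝 (g x)) := by
  have hu := memLp_indicator_one (μ := μ) hA 2
  obtain ⟨P, hP, -, hlim⟩ := exists_tendsto_eLpNorm_birkhoffAverage hf hu
  have hmeas := tendstoInMeasure_of_tendsto_eLpNorm two_ne_zero
    (fun N => (memLp_birkhoffAverage hf hu N).aestronglyMeasurable) hP.aestronglyMeasurable hlim
  obtain ⟨ns, hns, hae⟩ := hmeas.exists_seq_tendsto_ae
  set a : ℕ → Ω → ℝ := fun i => birkhoffAverage ℝ f (A.indicator 1) (ns i) with ha
  have ham : ∀ i, Measurable (a i) := fun i => by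
    have : a i = fun x => (ns i : ℝ)⁻¹ • ∑ n ∈ Finset.range (ns i), A.indicator 1 (f^[n] x) := rfl
    rw [this]
    refine Measurable.const_smul (Finset.measurable_fun_sum _ fun n _ => ?_) (ns i : ℝ)⁻¹
    exact (measurable_one.indicator hA).comp (hf.measurable.iterate n)
  -- The L² limit is invariant only almost everywhere. The limsup is invariant at every point, since
  -- averages at `x` and `f x` differ by boundary terms, so it is measurable for the invariant
  -- σ-algebra.
  refine ⟨ns, fun x => limsup (fun i => a i x) atTop, hns, ?_, ?_⟩
  · refine MeasurableSpace.measurable_invariants_dom.2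
      ⟨Measurable.limsup ham, fun s _ => ?_⟩
    congr 1
    funext x
    have hdiff : Tendsto (fun i => a i (f x) - a i x) atTop (𝓝 0) := by
      have hb : Bornology.IsBounded (Set.range (A.indicator (1 : Ω → ℝ))) :=
        (Metric.isBounded_Icc (0 : ℝ) 1).subset (Set.range_subset_iff.2 fun y => by
          by_cases hy : y ∈ A <;> simp [hy])
      exact (tendsto_birkhoffAverage_apply_sub_birkhoffAverage' ℝ hb f x).comp hns.tendsto_atTop
    have hbd : ∀ y, IsBoundedUnder (· ≤ ·) atTop (fun i => a i y) := fun y =>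
      isBoundedUnder_of ⟨1, fun i => (birkhoffAverage_indicator_mem_Icc f A _ y).2⟩
    have hbd' : ∀ y, IsBoundedUnder (· ≥ ·) atTop (fun i => a i y) := fun y =>
      isBoundedUnder_of ⟨0, fun i => (birkhoffAverage_indicator_mem_Icc f A _ y).1⟩
    have hle : ∀ y z, Tendsto (fun i => a i y - a i z) atTop (𝓝 0) →
        limsup (fun i => a i y) atTop ≤ limsup (fun i => a i z) atTop := by
      intro y z hyz
      refine le_of_forall_pos_le_add fun ε hε => ?_
      have h1 : limsup (fun i => a i z) atTop < limsup (fun i => a i z) atTop + ε / 2 := by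
        linarith
      refine limsup_le_of_le (hbd' y).isCoboundedUnder_le ?_
      filter_upwards [eventually_lt_of_limsup_lt h1 (hbd z),
        hyz.eventually (gt_mem_nhds (half_pos hε))] with i hi1 hi2
      linarith
    refine le_antisymm (hle _ _ hdiff) (hle _ _ ?_)
    simpa using hdiff.neg
  · filter_upwards [hae] with x hx
    have h1 : Tendsto (fun i => a i x) atTop (𝓝 (P x)) := hx
    rw [h1.limsup_eq]
    exact h1

/-- Along a subsequence, the averages of a set `A` converge to an invariant function, which is
constant on almost every component. Integrating over an invariant set `E` gives η(A ∩ E) = cη(E),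
and `E = univ` gives c = η(A): invariant sets are independent of a generating π-system. -/
theorem ae_ergodic_condExpKernel_invariants [IsProbabilityMeasure μ]
    (hf : MeasurePreserving f μ μ) :
    ∀ᵐ ω ∂μ, Ergodic f (condExpKernel μ (MeasurableSpace.invariants f) ω) := by
  obtain ⟨C, hCc, hCpi, hCgen⟩ := exists_countable_isPiSystem_generateFrom Ω
  have hm : MeasurableSpace.invariants f ≤ mΩ := MeasurableSpace.invariants_le f
  have hCm : ∀ A ∈ C, MeasurableSet A := fun A hA =>
    hCgen ▸ MeasurableSpace.measurableSet_generateFrom hA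
  have key : ∀ᵐ ω ∂μ, ∀ A ∈ C, ∃ (ns : ℕ → ℕ) (c : ℝ), StrictMono ns ∧
      ∀ᵐ x ∂condExpKernel μ (MeasurableSpace.invariants f) ω,
        Tendsto (fun i => birkhoffAverage ℝ f (A.indicator 1) (ns i) x) atTop (𝓝 c) := by
    refine (ae_ball_iff hCc).2 fun A hA => ?_
    obtain ⟨ns, g, hns, hg, hlim⟩ := exists_tendsto_birkhoffAverage_invariants hf (hCm A hA)
    filter_upwards [ae_ae_condExpKernel hm hlim, ae_ae_condExpKernel_eq hm hg] with ω h1 h2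
    refine ⟨ns, g ω, hns, ?_⟩
    filter_upwards [h1, h2] with x hx1 hx2
    rwa [← hx2]
  filter_upwards [ae_measurePreserving_condExpKernel_invariants hf, key] with ω hω hkey
  set η := condExpKernel μ (MeasurableSpace.invariants f) ω
  refine ⟨hω, ⟨fun D hD hfD => ?_⟩⟩
  have hprod : ∀ A ∈ C, η.real (A ∩ D) = η.real A * η.real D := by
    intro A hA
    obtain ⟨ns, c, hns, hlim⟩ := hkey A hA
    have hu := memLp_indicator_one (μ := η) (hCm A hA) 2
    have hE : ∀ E, MeasurableSet E → f ⁻¹' E = E → η.real (A ∩ E) = c * η.real E := by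
      intro E hEm hfE
      have hconv : Tendsto (fun i => ∫ x in E, birkhoffAverage ℝ f (A.indicator 1) (ns i) x ∂η)
          atTop (𝓝 (∫ _ in E, c ∂η)) := by
        refine tendsto_integral_of_dominated_convergence (fun _ => 1) (fun i => ?_)
          (integrable_const 1) (fun i => ae_of_all _ fun x => ?_) (ae_restrict_of_ae hlim)
        · exact (memLp_birkhoffAverage hω hu _).aestronglyMeasurable.restrict
        · have := birkhoffAverage_indicator_mem_Icc f A (ns i) x
          rw [Real.norm_eq_abs, abs_of_nonneg this.1]
          exact this.2
      rw [setIntegral_const, smul_eq_mul, mul_comm] at hconv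
      refine tendsto_nhds_unique (tendsto_const_nhds.congr' ?_) hconv
      filter_upwards [hns.tendsto_atTop.eventually_ne_atTop 0] with i hi
      exact (setIntegral_birkhoffAverage_of_invariant hω (hCm A hA) hEm hfE hi).symm
    have h1 := hE Set.univ MeasurableSet.univ rfl
    rw [Set.inter_univ, probReal_univ, mul_one] at h1
    rw [hE D hD hfD, h1]
  exact eventuallyConst_of_measureReal_inter_eq_mul hCgen hCpi hD hprod

/-- Almost every ergodic component projects onto a given ergodic factor. -/
theorem ae_map_condExpKernel_invariants_eq [IsProbabilityMeasure μ] {W : Type*}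
    [mW : MeasurableSpace W] [MeasurableSpace.CountablyGenerated W] {η : Measure W}
    [IsProbabilityMeasure η] {g : W → W} (hf : MeasurePreserving f μ μ) (hg : Ergodic g η)
    {p : Ω → W} (hp : MeasurePreserving p μ η) (hsemi : p ∘ f = g ∘ p) :
    ∀ᵐ ω ∂μ, (condExpKernel μ (MeasurableSpace.invariants f) ω).map p = η := by
  obtain ⟨C, hCc, hCpi, hCgen⟩ := exists_countable_isPiSystem_generateFrom W
  have hm : MeasurableSpace.invariants f ≤ mΩ := MeasurableSpace.invariants_le f
  have hCm : ∀ A ∈ C, MeasurableSet A := fun A hA =>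
    hCgen ▸ MeasurableSpace.measurableSet_generateFrom hA
  have hindep : ∀ A, MeasurableSet A → ∀ D, MeasurableSet[MeasurableSpace.invariants f] D →
      μ.real (p ⁻¹' A ∩ D) = η.real A * μ.real D := by
    intro A hA D hD
    obtain ⟨hD1, hD2⟩ := MeasurableSpace.measurableSet_invariants.1 hD
    -- This image is `g`-invariant and absolutely continuous with respect to the ergodic η, hence a
    -- multiple of it. So invariant sets are independent of the factor, and conditional
    -- probabilities of its sets are constant.
    set τ := (μ.restrict D).map p
    have hτ : MeasurePreserving g τ τ := by
      refine ⟨hg.measurable, ?_⟩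
      rw [Measure.map_map hg.measurable hp.measurable, ← hsemi,
        ← Measure.map_map hp.measurable hf.measurable]
      congr 1
      have := (hf.restrict_preimage hD1).map_eq
      rwa [hD2] at this
    have hac : τ ≪ η := by
      rw [← hp.map_eq]
      exact Measure.absolutelyContinuous_of_le Measure.restrict_le_self |>.map hp.measurable
    obtain ⟨c, hc⟩ := hg.eq_smul_of_absolutelyContinuous hτ hac
    have hcD : μ D = c := by
      have := congrArg (fun m : Measure W => m Set.univ) hc
      simpa [τ, Measure.map_apply hp.measurable] using this
    have hA' := congrArg (fun m : Measure W => m.real A) hc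
    simp only [τ, map_measureReal_apply hp.measurable hA,
      measureReal_restrict_apply (hp.measurable hA), measureReal_ennreal_smul_apply, ← hcD] at hA'
    rw [hA', mul_comm]; rfl
  have key : ∀ᵐ ω ∂μ, ∀ A ∈ C,
      (condExpKernel μ (MeasurableSpace.invariants f) ω).real (p ⁻¹' A) = η.real A := by
    refine (ae_ball_iff hCc).2 fun A hA => ?_
    refine condExpKernel_real_ae_eq hm (hp.measurable (hCm A hA)) (integrable_const _)
      stronglyMeasurable_const fun D hD => ?_
    rw [hindep A (hCm A hA) D hD, setIntegral_const, smul_eq_mul, mul_comm]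
  filter_upwards [key] with ω hω
  have : IsProbabilityMeasure ((condExpKernel μ (MeasurableSpace.invariants f) ω).map p) :=
    Measure.isProbabilityMeasure_map hp.measurable.aemeasurable
  refine ext_of_generate_finite C hCgen hCpi (fun A hA => ?_) (by simp)
  rw [Measure.map_apply hp.measurable (hCm A hA)]
  exact (ENNReal.toReal_eq_toReal_iff' (measure_ne_top _ _) (measure_ne_top _ _)).1 (hω A hA)

end ErgodicDecomposition

/-! ### Lifting joinings to extensions. -/

section RelativelyIndependentExtension

namespace JoiningPrimeness

variable {X Z W : Type*} [MeasurableSpace X] [MeasurableSpace Z] [MeasurableSpace W]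
  {μ : Measure X} {ρ : Measure Z} {ν : Measure W}
  {T : X ≃ᵐ X} {R : Z ≃ᵐ Z} {κ : Measure (X × Z)}

theorem isProbabilityMeasure_of_map_fst [IsProbabilityMeasure μ] (h : κ.map Prod.fst = μ) :
    IsProbabilityMeasure κ := by
  refine ⟨?_⟩
  have h1 := congrArg (fun m : Measure X => m Set.univ) h
  simpa [Measure.map_apply measurable_fst MeasurableSet.univ] using h1

/-- Invariance of κ in disintegrated form: `R` carries the fibre measure over `x` to the one over `T
x`. -/
theorem IsJoining.condKernel_comp_ae [StandardBorelSpace Z] [Nonempty Z] [IsProbabilityMeasure μ]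
    [IsFiniteMeasure κ] (hT : MeasurePreserving T μ μ) (hκ : IsJoining T μ R ρ κ) {A : Set Z}
    (hA : MeasurableSet A) :
    ∀ᵐ x ∂μ, κ.condKernel x (R ⁻¹' A) = κ.condKernel (T x) A := by
  have hdis : μ ⊗ₘ κ.condKernel = κ := by
    have := κ.disintegrate κ.condKernel
    rwa [Measure.fst, hκ.map_fst] at this
  have hrect : ∀ (B : Set X) (C : Set Z), MeasurableSet B → MeasurableSet C →
      ∫⁻ x in B, κ.condKernel x C ∂μ = κ (B ×ˢ C) := fun B C hB hC => by
    conv_rhs => rw [← hdis, Measure.compProd_apply_prod hB hC]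
  have hRA : MeasurableSet (R ⁻¹' A) := R.measurable hA
  refine ae_eq_of_forall_setLIntegral_eq_of_sigmaFinite (κ.condKernel.measurable_coe hRA)
    ((κ.condKernel.measurable_coe hA).comp T.measurable) fun B hB _ => ?_
  -- Invertibility of `T` enters here: testing on preimages tests on all sets.
  obtain ⟨B, rfl⟩ : ∃ B', B = T ⁻¹' B' := ⟨T.symm ⁻¹' B, by ext; simp⟩
  have hB' : MeasurableSet B := T.measurableSet_preimage.1 hB
  rw [hrect _ _ hB hRA]
  have := hT.setLIntegral_comp_preimage hB' (κ.condKernel.measurable_coe hA)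
  refine Eq.trans ?_ this.symm
  rw [hrect _ _ hB' hA, ← hκ.invariant.measure_preimage (hB'.prod hA).nullMeasurableSet]
  rfl

/-- Every joining of a factor with `R` lifts to a joining of the extension with `R`. -/
theorem IsJoining.exists_lift [StandardBorelSpace Z] [IsProbabilityMeasure μ]
    [IsProbabilityMeasure ρ] [IsProbabilityMeasure ν] (hT : MeasurePreserving T μ μ)
    (hκ : IsJoining T μ R ρ κ) {S : W → W}
    (hS : MeasurePreserving S ν ν) {π : W → X} (hπ : IsFactorMap S ν T μ π) :
    ∃ l : Measure (Z × W), IsJoining R ρ S ν l ∧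
      ∀ A B, MeasurableSet A → MeasurableSet B → l (A ×ˢ (π ⁻¹' B)) = κ (B ×ˢ A) := by
  have : IsProbabilityMeasure κ := isProbabilityMeasure_of_map_fst hκ.map_fst
  have : Nonempty Z := ρ.nonempty_of_neZero
  have hπm := hπ.measurePreserving
  have hdis : μ ⊗ₘ κ.condKernel = κ := by
    have := κ.disintegrate κ.condKernel
    rwa [Measure.fst, hκ.map_fst] at this
  -- Over `y` sits the fibre measure of κ over `π y`, so the lift is relatively independent over
  -- `X`.
  set K : Kernel W Z := κ.condKernel.comap π hπm.measurable
  have hl : ∀ (A : Set Z) (E : Set W), MeasurableSet A → MeasurableSet E →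
      ((ν ⊗ₘ K).map Prod.swap) (A ×ˢ E) = ∫⁻ y in E, κ.condKernel (π y) A ∂ν := by
    intro A E hA hE
    rw [Measure.map_apply measurable_swap (hA.prod hE), Set.preimage_swap_prod,
      Measure.compProd_apply_prod hE hA]
    rfl
  have hrect : ∀ A B, MeasurableSet A → MeasurableSet B →
      ((ν ⊗ₘ K).map Prod.swap) (A ×ˢ (π ⁻¹' B)) = κ (B ×ˢ A) := by
    intro A B hA hB
    rw [hl A _ hA (hπm.measurable hB)]
    have := hπm.setLIntegral_comp_preimage hB (κ.condKernel.measurable_coe hA)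
    refine this.trans ?_
    conv_rhs => rw [← hdis, Measure.compProd_apply_prod hB hA]
  have hprob : IsProbabilityMeasure ((ν ⊗ₘ K).map Prod.swap) :=
    Measure.isProbabilityMeasure_map measurable_swap.aemeasurable
  have hRS : Measurable (Prod.map R S) := R.measurable.prodMap hS.measurable
  refine ⟨(ν ⊗ₘ K).map Prod.swap, ⟨?_, ?_, ⟨hRS, ?_⟩⟩, hrect⟩
  · ext A hA
    rw [Measure.map_apply measurable_fst hA, ← Set.prod_univ, ← Set.preimage_univ (f := π),
      hrect A _ hA MeasurableSet.univ, Set.univ_prod, ← Measure.map_apply measurable_snd hA,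
      hκ.map_snd]
  · rw [Measure.map_map measurable_snd measurable_swap]
    exact Measure.fst_compProd ν K
  · have : IsProbabilityMeasure (((ν ⊗ₘ K).map Prod.swap).map (Prod.map R S)) :=
      Measure.isProbabilityMeasure_map hRS.aemeasurable
    refine Measure.ext_prod fun {A E} hA hE => ?_
    rw [Measure.map_apply hRS (hA.prod hE)]
    have hpre : Prod.map R S ⁻¹' (A ×ˢ E) = (R ⁻¹' A) ×ˢ (S ⁻¹' E) := rfl
    rw [hpre, hl _ _ (R.measurable hA) (hS.measurable hE), hl _ _ hA hE]
    have h1 := hπm.quasiMeasurePreserving.ae (hκ.condKernel_comp_ae hT hA)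
    have h2 := hπ.equivariant
    refine Eq.trans (lintegral_congr_ae (ae_restrict_of_ae ?_))
      (hS.setLIntegral_comp_preimage hE ((κ.condKernel.measurable_coe hA).comp hπm.measurable))
    filter_upwards [h1, h2] with y hy1 hy2
    simp only [Function.comp_apply] at hy2 ⊢
    rw [hy1, hy2]

end JoiningPrimeness

end RelativelyIndependentExtension

/-! ### Decorrelation of symmetric functions from few coordinates. -/

section SymmetricFunctions

theorem integrable_of_mem_Icc {Ω : Type*} [MeasurableSpace Ω] {μ : Measure Ω} [IsFiniteMeasure μ]
    {g : Ω → ℝ} (hg : Measurable g) (h : ∀ x, g x ∈ Set.Icc (0 : ℝ) 1) : Integrable g μ :=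
  (integrable_const (1 : ℝ)).mono' hg.aestronglyMeasurable (ae_of_all _ fun x => by
    rw [Real.norm_eq_abs, abs_of_nonneg (h x).1]; exact (h x).2)

theorem memLp_of_mem_Icc {Ω : Type*} [MeasurableSpace Ω] {μ : Measure Ω} [IsFiniteMeasure μ]
    {g : Ω → ℝ} (hg : Measurable g) (h : ∀ x, g x ∈ Set.Icc (0 : ℝ) 1) : MemLp g 2 μ :=
  MemLp.of_bound hg.aestronglyMeasurable 1 (ae_of_all _ fun x => by
    rw [Real.norm_eq_abs, abs_of_nonneg (h x).1]; exact (h x).2)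

theorem sq_integral_le_integral_sq {Ω : Type*} [MeasurableSpace Ω] {μ : Measure Ω}
    [IsProbabilityMeasure μ] {g : Ω → ℝ} (hg : MemLp g 2 μ) :
    (∫ x, g x ∂μ) ^ 2 ≤ ∫ x, g x ^ 2 ∂μ := by
  have h := variance_eq_sub hg
  have h' := variance_nonneg g μ
  simp only [Pi.pow_apply] at h
  linarith

theorem measurePreserving_comp_perm {ι Y : Type*} [Fintype ι] [MeasurableSpace Y] (ν : Measure Y)
    [IsProbabilityMeasure ν] (σ : Equiv.Perm ι) :
    MeasurePreserving (fun y : ι → Y => y ∘ σ) (Measure.pi fun _ => ν) (Measure.pi fun _ => ν) := by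
  have hm : Measurable (fun y : ι → Y => y ∘ σ) :=
    measurable_pi_lambda _ fun i => measurable_pi_apply (σ i)
  refine ⟨hm, (Measure.pi_eq fun s hs => ?_).symm⟩
  rw [Measure.map_apply hm (MeasurableSet.univ_pi hs)]
  have : (fun y : ι → Y => y ∘ σ) ⁻¹' (Set.univ.pi s) = Set.univ.pi (s ∘ σ.symm) := by
    ext y
    simp only [Set.mem_preimage, Set.mem_univ_pi, Function.comp_apply]
    exact ⟨fun h i => by simpa using h (σ.symm i), fun h i => by simpa using h (σ i)⟩
  rw [this, Measure.pi_pi]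
  exact Equiv.prod_comp σ.symm fun i => ν (s i)

/-- A symmetric function of many independent variables is almost uncorrelated with any function
of few of them. -/
theorem abs_integral_mul_sub_le_of_symmetric {ι Y : Type*} [Fintype ι] [MeasurableSpace Y]
    (ν : Measure Y) [IsProbabilityMeasure ν] (I : Finset ι) {m : ℕ} (hm : m ≠ 0)
    (hcard : m * I.card ≤ Fintype.card ι) {F : (ι → Y) → ℝ} (hF : Measurable F)
    (hF01 : ∀ y, F y ∈ Set.Icc (0 : ℝ) 1) (hsym : ∀ (σ : Equiv.Perm ι) y, F (y ∘ σ) = F y)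
    {H : (I → Y) → ℝ} (hH : Measurable H) (hH01 : ∀ y, H y ∈ Set.Icc (0 : ℝ) 1) :
    |∫ y, F y * H (fun i => y i) ∂(Measure.pi fun _ => ν) -
      (∫ y, F y ∂(Measure.pi fun _ => ν)) *
        ∫ y : ι → Y, H (fun i => y i) ∂(Measure.pi fun _ => ν)| ≤ (√m)⁻¹ := by
  classical
  set P : Measure (ι → Y) := Measure.pi fun _ => ν
  -- There is room for `m` disjoint copies of `I`; the permutation `σ j` carries `I` onto the `j`-th
  -- copy.
  obtain ⟨φ⟩ : Nonempty (Fin m × I ↪ ι) :=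
    Function.Embedding.nonempty_of_card_le (by simpa using hcard)
  have hσ : ∀ j : Fin m, ∃ σ : Equiv.Perm ι, ∀ i : I, σ i = φ (j, i) := fun j => by
    obtain ⟨σ, hσ⟩ := Equiv.Perm.exists_extending_pair (fun i : I => (i : ι))
      (fun i : I => φ (j, i)) Subtype.val_injective
      (fun a b hab => (Prod.ext_iff.1 (φ.injective hab)).2)
    exact ⟨σ, hσ⟩
  choose σ hσ using hσ
  set h : (ι → Y) → ℝ := fun y => H fun i => y i with hh
  have hhm : Measurable h := hH.comp (measurable_pi_lambda _ fun i => measurable_pi_apply _)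
  have hσm : ∀ j, MeasurePreserving (fun y : ι → Y => y ∘ σ j) P P := fun j =>
    measurePreserving_comp_perm ν (σ j)
  set G : Fin m → (ι → Y) → ℝ := fun j y => h (y ∘ σ j) with hG
  have hGm : ∀ j, Measurable (G j) := fun j => hhm.comp (hσm j).measurable
  have hG01 : ∀ j y, G j y ∈ Set.Icc (0 : ℝ) 1 := fun j y => hH01 _
  have hGL : ∀ j, MemLp (G j) 2 P := fun j => memLp_of_mem_Icc (hGm j) (hG01 j)
  have hGint : ∀ j, ∫ y, G j y ∂P = ∫ y, h y ∂P := fun j => by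
    conv_rhs => rw [← (hσm j).map_eq, integral_map (hσm j).aemeasurable
      hhm.aestronglyMeasurable]
  -- This is the use of symmetry: permuting coordinates moves `h` to `G j` and fixes both `F` and
  -- the product measure.
  have hFG : ∀ j, ∫ y, F y * G j y ∂P = ∫ y, F y * h y ∂P := fun j => by
    conv_rhs => rw [← (hσm j).map_eq, integral_map (hσm j).aemeasurable
      (show Measurable fun y => F y * h y from hF.mul hhm).aestronglyMeasurable]
    simp only [hsym, hG]
  have hindep : Pairwise fun j l => IndepFun (G j) (G l) P := by
    intro j l hjl
    have hcoord : iIndepFun (fun (i : ι) (y : ι → Y) => y i) P :=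
      iIndepFun_pi (X := fun (_ : ι) (y : Y) => y) fun _ => aemeasurable_id
    set s : Fin m → Finset ι := fun j => Finset.univ.image fun i : I => φ (j, i)
    have hmem : ∀ j i, φ (j, i) ∈ s j := fun j i =>
      Finset.mem_image_of_mem _ (Finset.mem_univ i)
    have hdisj : Disjoint (s j) (s l) := by
      rw [Finset.disjoint_left]
      intro a ha hb
      obtain ⟨i, -, rfl⟩ := Finset.mem_image.1 ha
      obtain ⟨i', -, hi'⟩ := Finset.mem_image.1 hb
      exact hjl (Prod.ext_iff.1 (φ.injective hi')).1.symm
    have hind := hcoord.indepFun_finset (s j) (s l) hdisj fun i => measurable_pi_apply i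
    have hcomp : ∀ j, G j = (fun v : s j → Y => H fun i => v ⟨φ (j, i), hmem j i⟩) ∘
        fun y i => y i := fun j => by
      ext y
      simp only [hG, hh, Function.comp_apply, hσ]
    have hmeas : ∀ j, Measurable fun v : s j → Y => H fun i => v ⟨φ (j, i), hmem j i⟩ := fun j =>
      hH.comp (measurable_pi_lambda _ fun i => measurable_pi_apply _)
    rw [hcomp j, hcomp l]
    exact hind.comp (hmeas j) (hmeas l)
  set c := ∫ y, h y ∂P
  set V : (ι → Y) → ℝ := ∑ j, G j with hV
  have hVL : MemLp V 2 P := memLp_finsetSum' _ fun j _ => hGL j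
  have hVint : ∫ y, V y ∂P = m * c := by
    simp only [hV, Finset.sum_apply]
    rw [integral_finsetSum _ fun j _ => (hGL j).integrable one_le_two]
    simp [hGint, c]
  have hvar : ∫ y, (V y - m * c) ^ 2 ∂P ≤ m := by
    have h1 := variance_eq_integral (μ := P) hVL.aestronglyMeasurable.aemeasurable
    rw [hVint] at h1
    rw [← h1, IndepFun.variance_sum (fun j _ => hGL j) (fun j _ l _ hjl => hindep hjl)]
    calc ∑ j, Var[G j; P] ≤ ∑ _j : Fin m, (1 : ℝ) := Finset.sum_le_sum fun j _ => by
          refine (variance_le_sq_of_bounded (ae_of_all _ (hG01 j)) (hGm j).aemeasurable).trans ?_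
          norm_num
      _ = m := by simp
  have hVc : MemLp (fun y => V y - m * c) 2 P := hVL.sub (memLp_const _)
  have habs : ∫ y, |V y - m * c| ∂P ≤ √m := by
    refine Real.le_sqrt_of_sq_le ?_
    refine (sq_integral_le_integral_sq hVc.norm).trans ?_
    simpa only [Real.norm_eq_abs, sq_abs] using hvar
  have hFi : Integrable F P := integrable_of_mem_Icc hF hF01
  have hFGi : ∀ j, Integrable (fun y => F y * G j y) P := fun j =>
    integrable_of_mem_Icc (hF.mul (hGm j)) fun y =>
      ⟨mul_nonneg (hF01 y).1 (hG01 j y).1, mul_le_one₀ (hF01 y).2 (hG01 j y).1 (hG01 j y).2⟩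
  -- The covariance is amplified by the factor `m`, whereas the integral is at most the mean
  -- absolute deviation of `V`, which pairwise independence bounds by √m.
  have hsum : ∫ y, F y * (V y - m * c) ∂P =
      m * (∫ y, F y * h y ∂P - (∫ y, F y ∂P) * c) := by
    have h1 : ∀ y, F y * (V y - m * c) = ∑ j, F y * G j y - F y * (m * c) := fun y => by
      simp only [hV, Finset.sum_apply]; rw [mul_sub, Finset.mul_sum]
    simp_rw [h1]
    rw [integral_sub (integrable_finsetSum _ fun j _ => hFGi j) (hFi.mul_const _),
      integral_finsetSum _ fun j _ => hFGi j, integral_mul_const]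
    simp only [hFG, Finset.sum_const, Finset.card_univ, Fintype.card_fin, nsmul_eq_mul]
    ring
  have hbound : |∫ y, F y * (V y - m * c) ∂P| ≤ √m := by
    refine (abs_integral_le_integral_abs).trans (le_trans ?_ habs)
    refine integral_mono_of_nonneg (ae_of_all _ fun _ => abs_nonneg _)
      (hVc.norm.integrable one_le_two) (ae_of_all _ fun y => ?_)
    simp only [abs_mul, abs_of_nonneg (hF01 y).1]
    exact mul_le_of_le_one_left (abs_nonneg _) (hF01 y).2
  have hmpos : (0 : ℝ) < m := by exact_mod_cast Nat.pos_of_ne_zero hm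
  rw [hsum, abs_mul, abs_of_pos hmpos] at hbound
  rw [← one_div, le_div_iff₀ (Real.sqrt_pos.2 hmpos)]
  have hs : √(m : ℝ) * √m = m := Real.mul_self_sqrt hmpos.le
  have hsp := Real.sqrt_pos.2 hmpos
  refine le_of_mul_le_mul_right ?_ hsp
  rw [mul_assoc, hs, one_mul, mul_comm]
  exact hbound

end SymmetricFunctions

/-! ### Densities for independent extensions. -/

section IndepExtension

namespace JoiningPrimeness

/-- In an independent extension, the conditional expectation of a set in `Z` given all the
coordinates depends only on the coordinates in `I`. -/
theorem IsIndepExtension.exists_density {Z : Type*} [MeasurableSpace Z] {k : ℕ} {Y : Type*}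
    [MeasurableSpace Y] {ν : Measure Y} [IsProbabilityMeasure ν] {l : Measure (Z × (Fin k → Y))}
    (hsnd : l.map Prod.snd = Measure.pi fun _ => ν) {I : Finset (Fin k)}
    (hI : IsIndepExtension (fun _ => ν) l I) {A : Set Z} (hA : MeasurableSet A) :
    ∃ H : (I → Y) → ℝ, Measurable H ∧ (∀ y, H y ∈ Set.Icc (0 : ℝ) 1) ∧
      ∀ F : (Fin k → Y) → ℝ, Measurable F →
        ∫ p in A ×ˢ Set.univ, F p.2 ∂l =
          ∫ y, F y * H (fun i => y i) ∂(Measure.pi fun _ => ν) := by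
  have hl : IsProbabilityMeasure l := by
    refine ⟨?_⟩
    have h1 := congrArg (fun m : Measure (Fin k → Y) => m Set.univ) hsnd
    simpa [Measure.map_apply measurable_snd MeasurableSet.univ] using h1
  set e := MeasurableEquiv.piEquivPiSubtypeProd (fun _ : Fin k => Y) (· ∈ I)
  have hemp : MeasurePreserving e (Measure.pi fun _ => ν)
      ((Measure.pi fun _ => ν).prod (Measure.pi fun _ => ν)) :=
    by convert measurePreserving_piEquivPiSubtypeProd (fun _ : Fin k => ν) (· ∈ I)
  set νI : Measure ({i // i ∈ I} → Y) := Measure.pi fun _ => ν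
  set νJ : Measure ({i // i ∉ I} → Y) := Measure.pi fun _ => ν
  have hr : Measurable fun y : Fin k → Y => fun i : {i // i ∈ I} => y i :=
    measurable_pi_lambda _ fun i => measurable_pi_apply _
  have hrJ : Measurable fun y : Fin k → Y => fun i : {i // i ∉ I} => y i :=
    measurable_pi_lambda _ fun i => measurable_pi_apply _
  -- The law of the `I`-coordinates on the event that the `Z`-coordinate lies in `A`. It is
  -- dominated by the product measure, so its density is at most 1; the remaining coordinates stay
  -- independent.
  set mI : Measure ({i // i ∈ I} → Y) :=
    (l.restrict (A ×ˢ Set.univ)).map fun p => fun i => p.2 i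
  have hle : mI ≤ νI := by
    have h1 : νI = l.map fun p => fun i : {i // i ∈ I} => p.2 i := by
      have h2 : νI = (Measure.pi fun _ : Fin k => ν).map
          fun y => fun i : {i // i ∈ I} => y i := by
        have h3 := congrArg (fun m => m.map Prod.fst) hemp.map_eq
        simp only [Measure.map_map measurable_fst e.measurable] at h3
        rw [← Measure.fst, Measure.fst_prod] at h3
        exact h3.symm
      rw [h2, ← hsnd, Measure.map_map hr measurable_snd]
      rfl
    rw [h1]
    exact Measure.map_mono Measure.restrict_le_self (hr.comp measurable_snd)
  -- Truncation turns the almost everywhere bound by 1 into a pointwise one.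
  set d : ({i // i ∈ I} → Y) → ENNReal := fun v => min (mI.rnDeriv νI v) 1
  have hd : Measurable d := (Measure.measurable_rnDeriv _ _).min measurable_const
  have hd1 : ∀ v, d v ≤ 1 := fun v => min_le_right _ _
  have : IsFiniteMeasure mI := isFiniteMeasure_of_le νI hle
  have hmI : mI = νI.withDensity d := by
    conv_lhs => rw [← Measure.withDensity_rnDeriv_eq mI νI
      (Measure.absolutelyContinuous_of_le hle)]
    refine withDensity_congr_ae ?_
    filter_upwards [Measure.rnDeriv_le_one_of_le hle] with v hv
    exact (min_eq_left hv).symm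
  have hmap : ((l.restrict (A ×ˢ Set.univ)).map Prod.snd).map e = mI.prod νJ := by
    rw [Measure.map_map e.measurable measurable_snd]
    have : IsFiniteMeasure ((l.restrict (A ×ˢ Set.univ)).map (e ∘ Prod.snd)) :=
      Measure.isFiniteMeasure_map _ _
    refine Measure.ext_prod fun {U V} hU hV => ?_
    rw [Measure.map_apply (e.measurable.comp measurable_snd) (hU.prod hV),
      Measure.restrict_apply ((e.measurable.comp measurable_snd) (hU.prod hV)),
      Measure.prod_prod, show mI U = _ from Measure.map_apply (hr.comp measurable_snd) hU,
      Measure.restrict_apply ((hr.comp measurable_snd) hU)]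
    have h1 := congrArg (fun m => m ((A ×ˢ U) ×ˢ V)) hI
    simp only at h1
    have hm1 : Measurable fun p : Z × (Fin k → Y) => (p.1, fun i : {i // i ∈ I} => p.2 i) :=
      measurable_fst.prodMk (hr.comp measurable_snd)
    have hm2 : Measurable fun p : Z × (Fin k → Y) =>
        ((p.1, fun i : {i // i ∈ I} => p.2 i), fun j : {j // j ∉ I} => p.2 j) :=
      hm1.prodMk (hrJ.comp measurable_snd)
    rw [Measure.map_apply hm2 ((hA.prod hU).prod hV),
      Measure.prod_prod, Measure.map_apply hm1 (hA.prod hU)] at h1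
    convert h1 using 2
    · ext p
      simp only [Set.mem_inter_iff, Set.mem_preimage, Function.comp_apply, Set.mem_prod,
        Set.mem_univ, and_true]
      constructor
      · rintro ⟨⟨a, b⟩, c⟩; exact ⟨⟨c, a⟩, b⟩
      · rintro ⟨⟨c, a⟩, b⟩; exact ⟨⟨a, b⟩, c⟩
    · congr 1
      ext p
      simp only [Set.mem_inter_iff, Set.mem_preimage, Set.mem_prod, Set.mem_univ, and_true]
      exact and_comm
  refine ⟨fun v => (d v).toReal, hd.ennreal_toReal, fun v => ⟨ENNReal.toReal_nonneg, ?_⟩,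
    fun F hF => ?_⟩
  · exact ENNReal.toReal_le_of_le_ofReal zero_le_one (by simpa using hd1 v)
  · calc ∫ p in A ×ˢ Set.univ, F p.2 ∂l
        = ∫ y, F y ∂((l.restrict (A ×ˢ Set.univ)).map Prod.snd) :=
          (integral_map measurable_snd.aemeasurable hF.aestronglyMeasurable).symm
      _ = ∫ q, F (e.symm q) ∂(((l.restrict (A ×ˢ Set.univ)).map Prod.snd).map e) := by
          rw [integral_map_equiv]; simp
      _ = ∫ q, F (e.symm q) ∂((νI.prod νJ).withDensity fun q => d q.1) := by
          rw [hmap, hmI, prod_withDensity_left hd]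
      _ = ∫ q, (d q.1).toReal • F (e.symm q) ∂(νI.prod νJ) :=
          integral_withDensity_eq_integral_toReal_smul (hd.comp measurable_fst)
            (ae_of_all _ fun q => (hd1 _).trans_lt ENNReal.one_lt_top) _
      _ = ∫ y, F y * (d fun i => y i).toReal ∂(Measure.pi fun _ => ν) := by
          rw [← hemp.map_eq, integral_map_equiv]
          refine integral_congr_ae (ae_of_all _ fun y => ?_)
          simp only [MeasurableEquiv.symm_apply_apply, smul_eq_mul]
          rw [mul_comm]; rfl

end JoiningPrimeness

end IndepExtension

/-! ### Quantitative decorrelation and disjointness. -/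

namespace JoiningPrimeness

theorem symmetricFactor_le (Y : Type*) [MeasurableSpace Y] (k : ℕ) :
    symmetricFactor Y k ≤ MeasurableSpace.pi := fun _ hs => hs.1

/-- Level sets belong to the symmetric factor, so they are invariant under permutations exactly, not
just modulo null sets. -/
theorem comp_perm_eq_of_measurable_symmetricFactor {Y β : Type*} [MeasurableSpace Y] {k : ℕ}
    [MeasurableSpace β] [MeasurableSingletonClass β] {F : (Fin k → Y) → β}
    (hF : Measurable[symmetricFactor Y k] F) (σ : Equiv.Perm (Fin k)) (y : Fin k → Y) :
    F (y ∘ σ) = F y := by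
  have h := (hF (measurableSet_singleton (F y))).2 σ
  have hy : y ∈ F ⁻¹' {F y} := rfl
  rw [← h] at hy
  exact hy

theorem abs_sub_clamp_le {b : ℝ} (hb : b ∈ Set.Icc (0 : ℝ) 1) (r : ℝ) :
    |b - max 0 (min 1 r)| ≤ |b - r| := by
  obtain ⟨h0, h1⟩ := hb
  rcases le_total r 0 with hr | hr
  · rw [min_eq_right (hr.trans zero_le_one), max_eq_left hr, abs_of_nonneg (by linarith),
      abs_of_nonneg (by linarith)]
    linarith
  · rcases le_total r 1 with hr1 | hr1
    · rw [min_eq_right hr1, max_eq_right hr]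
    · rw [min_eq_left hr1, max_eq_right zero_le_one, abs_of_nonpos (by linarith),
        abs_of_nonpos (by linarith)]
      linarith

theorem integral_norm_le_norm_Lp {𝕜 Ω : Type*} [RCLike 𝕜] [MeasurableSpace Ω] {P : Measure Ω}
    [IsProbabilityMeasure P] (G : Lp 𝕜 2 P) : ∫ x, ‖G x‖ ∂P ≤ ‖G‖ := by
  have hG := Lp.memLp G
  rw [Lp.norm_def, integral_norm_eq_lintegral_enorm hG.aestronglyMeasurable,
    ← eLpNorm_one_eq_lintegral_enorm]
  exact ENNReal.toReal_mono hG.eLpNorm_ne_top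
    (eLpNorm_le_eLpNorm_of_exponent_le one_le_two hG.aestronglyMeasurable)

/-- If the indicator of `B`, lifted along `π`, is `L²`-close to the symmetric factor, then it is
`L¹`-close to a symmetric function with values in the unit interval. -/
theorem exists_symmetric_of_distSymmetric_lt {𝕜 X Y : Type*} [RCLike 𝕜] [MeasurableSpace X]
    [MeasurableSpace Y] {k : ℕ} {μ : Measure X} [IsProbabilityMeasure μ] {ν : Measure Y}
    [IsProbabilityMeasure ν] {π : (Fin k → Y) → X}
    (hπ : MeasurePreserving π (Measure.pi fun _ => ν) μ) {B : Set X} (hB : MeasurableSet B)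
    {ε : ℝ} (h : distSymmetric (Lp.compMeasurePreserving π hπ
      (indicatorConstLp 2 hB (measure_ne_top μ B) (1 : 𝕜))) < ε) :
    ∃ F : (Fin k → Y) → ℝ, Measurable F ∧ (∀ y, F y ∈ Set.Icc (0 : ℝ) 1) ∧
      (∀ (σ : Equiv.Perm (Fin k)) y, F (y ∘ σ) = F y) ∧
      ∫ y, |(π ⁻¹' B).indicator 1 y - F y| ∂(Measure.pi fun _ => ν) ≤ ε := by
  set P : Measure (Fin k → Y) := Measure.pi fun _ => ν
  set G := Lp.compMeasurePreserving π hπ (indicatorConstLp 2 hB (measure_ne_top μ B) (1 : 𝕜))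
  obtain ⟨G', hG', hdist⟩ := (Metric.infDist_lt_iff ⟨0, Submodule.zero_mem _⟩).1 h
  have hG'm : AEStronglyMeasurable[symmetricFactor Y k] G' P :=
    mem_lpMeas_iff_aestronglyMeasurable.1 hG'
  obtain ⟨g, hg, hgG⟩ := hG'm
  -- Taking real parts and truncating to [0,1] preserves symmetry and does not increase the distance
  -- to an indicator.
  have hFm : Measurable[symmetricFactor Y k] fun y => max 0 (min 1 (RCLike.re (g y))) :=
    measurable_const.max (measurable_const.min (RCLike.measurable_re.comp hg.measurable))
  refine ⟨fun y => max 0 (min 1 (RCLike.re (g y))), hFm.mono (symmetricFactor_le Y k) le_rfl,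
    fun y => ⟨le_max_left _ _, max_le zero_le_one (min_le_left _ _)⟩,
    fun σ y => comp_perm_eq_of_measurable_symmetricFactor hFm σ y, ?_⟩
  refine le_trans ?_ ((integral_norm_le_norm_Lp (G - G')).trans
    ((dist_eq_norm G G').symm.trans_lt hdist).le)
  have hGae : G =ᵐ[P] fun y => (π ⁻¹' B).indicator (fun _ => (1 : 𝕜)) y :=
    (Lp.coeFn_compMeasurePreserving _ hπ).trans
      (hπ.quasiMeasurePreserving.ae_eq_comp indicatorConstLp_coeFn)
  refine integral_mono_of_nonneg (ae_of_all _ fun _ => abs_nonneg _)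
    ((Lp.memLp (G - G')).integrable one_le_two).norm ?_
  filter_upwards [hGae, hgG, Lp.coeFn_sub G G'] with y h1 h2 h3
  rw [h3, Pi.sub_apply, h1, h2]
  set b : ℝ := (π ⁻¹' B).indicator 1 y with hb
  have hb01 : b ∈ Set.Icc (0 : ℝ) 1 := by
    by_cases hy : y ∈ π ⁻¹' B <;> simp [hb, hy]
  have hbre : b = RCLike.re ((π ⁻¹' B).indicator (fun _ => (1 : 𝕜)) y) := by
    by_cases hy : y ∈ π ⁻¹' B <;> simp [hb, hy]
  refine (abs_sub_clamp_le hb01 _).trans ?_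
  rw [hbre, ← map_sub]
  exact RCLike.abs_re_le_norm _

/-- With `h` the density attached to `A`, the indicator of `E` is replaced by `F` in the correlation
with `h` and in the product of means, at cost ε each; decorrelating `F` from `h` costs 1/√m. -/
theorem IsIndepExtension.abs_measureReal_prod_sub_le {Z Y : Type*} [MeasurableSpace Z] {k : ℕ}
    [MeasurableSpace Y] {ρ : Measure Z} {ν : Measure Y} [IsProbabilityMeasure ν]
    {l : Measure (Z × (Fin k → Y))} (hfst : l.map Prod.fst = ρ)
    (hsnd : l.map Prod.snd = Measure.pi fun _ => ν) {I : Finset (Fin k)}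
    (hI : IsIndepExtension (fun _ => ν) l I) {m : ℕ} (hm : m ≠ 0) (hcard : m * I.card ≤ k)
    {A : Set Z} (hA : MeasurableSet A) {E : Set (Fin k → Y)} (hE : MeasurableSet E)
    {F : (Fin k → Y) → ℝ} (hF : Measurable F) (hF01 : ∀ y, F y ∈ Set.Icc (0 : ℝ) 1)
    (hsym : ∀ (σ : Equiv.Perm (Fin k)) y, F (y ∘ σ) = F y) {ε : ℝ}
    (hε : ∫ y, |E.indicator 1 y - F y| ∂(Measure.pi fun _ => ν) ≤ ε) :
    |l.real (A ×ˢ E) - ρ.real A * (Measure.pi fun _ : Fin k => ν).real E| ≤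
      2 * ε + (√m)⁻¹ := by
  obtain ⟨H, hH, hH01, hHint⟩ := hI.exists_density hsnd hA
  have hsymm := abs_integral_mul_sub_le_of_symmetric ν I hm (by simpa using hcard) hF hF01 hsym
    hH hH01
  set P : Measure (Fin k → Y) := Measure.pi fun _ => ν
  set h : (Fin k → Y) → ℝ := fun y => H fun i => y i with hh
  have hhm : Measurable h := hH.comp (measurable_pi_lambda _ fun i => measurable_pi_apply _)
  have hh01 : ∀ y, h y ∈ Set.Icc (0 : ℝ) 1 := fun y => hH01 _
  set u : (Fin k → Y) → ℝ := E.indicator 1 with hu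
  have hum : Measurable u := measurable_one.indicator hE
  have hu01 : ∀ y, u y ∈ Set.Icc (0 : ℝ) 1 := fun y => by
    by_cases hy : y ∈ E <;> simp [hu, hy]
  have hint : ∀ {v w : (Fin k → Y) → ℝ}, Measurable v → Measurable w →
      (∀ y, v y ∈ Set.Icc (0 : ℝ) 1) → (∀ y, w y ∈ Set.Icc (0 : ℝ) 1) →
      Integrable (fun y => v y * w y) P := fun hv hw hv1 hw1 =>
    integrable_of_mem_Icc (hv.mul hw) fun y =>
      ⟨mul_nonneg (hv1 y).1 (hw1 y).1, mul_le_one₀ (hv1 y).2 (hw1 y).1 (hw1 y).2⟩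
  have hui : Integrable u P := integrable_of_mem_Icc hum hu01
  have hFi : Integrable F P := integrable_of_mem_Icc hF hF01
  have hAE : l.real (A ×ˢ E) = ∫ y, u y * h y ∂P := by
    rw [← hHint u hum]
    have h1 : ∀ p : Z × (Fin k → Y), u p.2 = (Set.univ ×ˢ E).indicator 1 p := fun p => by
      by_cases hp : p.2 ∈ E <;> simp [hu, hp]
    simp_rw [h1]
    rw [integral_indicator_one (MeasurableSet.univ.prod hE),
      measureReal_restrict_apply (MeasurableSet.univ.prod hE), Set.prod_inter_prod,
      Set.univ_inter, Set.inter_univ]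
  have hhA : ∫ y, h y ∂P = ρ.real A := by
    have h1 := hHint (fun _ => 1) measurable_const
    simp only [one_mul] at h1
    rw [← h1, ← hfst, map_measureReal_apply measurable_fst hA, setIntegral_const, smul_eq_mul,
      mul_one, Set.prod_univ]
  have huE : ∫ y, u y ∂P = P.real E := integral_indicator_one hE
  have habsi : Integrable (fun y => |u y - F y|) P := (hui.sub hFi).abs
  have e1 : |∫ y, u y * h y ∂P - ∫ y, F y * h y ∂P| ≤ ε := by
    rw [← integral_sub (hint hum hhm hu01 hh01) (hint hF hhm hF01 hh01)]
    refine abs_integral_le_integral_abs.trans (le_trans ?_ hε)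
    refine integral_mono_of_nonneg (ae_of_all _ fun _ => abs_nonneg _) habsi
      (ae_of_all _ fun y => ?_)
    simp only [← sub_mul, abs_mul, abs_of_nonneg (hh01 y).1]
    exact mul_le_of_le_one_right (abs_nonneg _) (hh01 y).2
  have e2 : |∫ y, F y ∂P - ∫ y, u y ∂P| ≤ ε := by
    rw [abs_sub_comm, ← integral_sub hui hFi]
    exact abs_integral_le_integral_abs.trans hε
  have hc01 : 0 ≤ ∫ y, h y ∂P ∧ ∫ y, h y ∂P ≤ 1 := by
    refine ⟨integral_nonneg fun y => (hh01 y).1, ?_⟩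
    simpa using integral_mono (integrable_of_mem_Icc hhm hh01) (integrable_const (μ := P) (1 : ℝ))
      fun y => (hh01 y).2
  have e3 : |(∫ y, F y ∂P) * ∫ y, h y ∂P - (∫ y, u y ∂P) * ∫ y, h y ∂P| ≤ ε := by
    rw [← sub_mul, abs_mul, abs_of_nonneg hc01.1]
    exact (mul_le_of_le_one_right (abs_nonneg _) hc01.2).trans e2
  rw [hAE, ← huE, ← hhA, mul_comm (∫ y, h y ∂P)]
  calc |∫ y, u y * h y ∂P - (∫ y, u y ∂P) * ∫ y, h y ∂P|
      ≤ |∫ y, u y * h y ∂P - ∫ y, F y * h y ∂P|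
        + |∫ y, F y * h y ∂P - (∫ y, F y ∂P) * ∫ y, h y ∂P|
        + |(∫ y, F y ∂P) * ∫ y, h y ∂P - (∫ y, u y ∂P) * ∫ y, h y ∂P| := by
        refine le_trans (le_of_eq ?_) (abs_add_three _ _ _)
        congr 1; ring
    _ ≤ ε + (√m)⁻¹ + ε := by gcongr
    _ = 2 * ε + (√m)⁻¹ := by ring

/-- Quantitative decorrelation of an automorphism with the property `JP n` from a factor of
`S ^ k`, on sets which are almost symmetric. -/
theorem JP.abs_measureReal_joining_sub_le {n : ℕ} {X : Type u} [MeasurableSpace X]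
    {μ : Measure X} [IsProbabilityMeasure μ] {T : X ≃ᵐ X} (hT : MeasurePreserving T μ μ)
    {Z : Type v} [MeasurableSpace Z] [StandardBorelSpace Z] {ρ : Measure Z}
    [IsProbabilityMeasure ρ] {R : Z ≃ᵐ Z} (hR : JP.{v, w} n R ρ) {k : ℕ} (hk : n + 1 ≤ k)
    {Y : Type w} [MeasurableSpace Y] [StandardBorelSpace Y] {ν : Measure Y}
    [IsProbabilityMeasure ν] {S : Y ≃ᵐ Y} (hS : IsWeaklyMixing S ν) {π : (Fin k → Y) → X}
    (hπ : IsFactorMap (Pi.map fun _ : Fin k => S) (Measure.pi fun _ : Fin k => ν) T μ π)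
    {m : ℕ} (hm : m ≠ 0) (hmk : m * n ≤ k) {κ : Measure (X × Z)} (hκ : IsJoining T μ R ρ κ)
    {A : Set Z} (hA : MeasurableSet A) {B : Set X} (hB : MeasurableSet B)
    {F : (Fin k → Y) → ℝ} (hF : Measurable F) (hF01 : ∀ y, F y ∈ Set.Icc (0 : ℝ) 1)
    (hsym : ∀ (σ : Equiv.Perm (Fin k)) y, F (y ∘ σ) = F y) {ε : ℝ}
    (hε : ∫ y, |(π ⁻¹' B).indicator 1 y - F y| ∂(Measure.pi fun _ => ν) ≤ ε) :
    |κ.real (B ×ˢ A) - ρ.real A * μ.real B| ≤ 2 * ε + (√m)⁻¹ := by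
  have hSk : Ergodic (Pi.map fun _ : Fin k => S) (Measure.pi fun _ : Fin k => ν) :=
    ergodic_pi_of_isWeaklyMixing fun _ => hS
  obtain ⟨l, hl, hlκ⟩ := hκ.exists_lift hT hSk.toMeasurePreserving hπ
  have hlprob : IsProbabilityMeasure l := isProbabilityMeasure_of_map_fst hl.map_fst
  set f := Prod.map R (Pi.map fun _ : Fin k => S)
  have hE : MeasurableSet (π ⁻¹' B) := hπ.measurePreserving.measurable hB
  have hAE : MeasurableSet (A ×ˢ (π ⁻¹' B)) := hA.prod hE
  have hκl : κ.real (B ×ˢ A) = l.real (A ×ˢ (π ⁻¹' B)) :=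
    congrArg ENNReal.toReal (hlκ A B hA hB).symm
  have hμB : μ.real B = (Measure.pi fun _ : Fin k => ν).real (π ⁻¹' B) :=
    (hπ.measurePreserving.measureReal_preimage hB.nullMeasurableSet).symm
  set K := condExpKernel l (MeasurableSpace.invariants f)
  have hm' : MeasurableSpace.invariants f ≤ Prod.instMeasurableSpace :=
    MeasurableSpace.invariants_le f
  -- Ergodicity of `R` and of `S^k` keeps both marginals in almost every component, so JP(n) applies
  -- there. The selected coordinates depend on ω, but the bound does not, and no measurable choice
  -- is needed.
  have hcomp : ∀ᵐ ω ∂l, |(K ω).real (A ×ˢ (π ⁻¹' B)) -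
      ρ.real A * (Measure.pi fun _ : Fin k => ν).real (π ⁻¹' B)| ≤ 2 * ε + (√m)⁻¹ := by
    filter_upwards [ae_ergodic_condExpKernel_invariants hl.invariant,
      ae_map_condExpKernel_invariants_eq hl.invariant hR.ergodic ⟨measurable_fst, hl.map_fst⟩ rfl,
      ae_map_condExpKernel_invariants_eq hl.invariant hSk ⟨measurable_snd, hl.map_snd⟩ rfl]
      with ω h1 h2 h3
    obtain ⟨i, hi⟩ := hR.exists_isIndepExtension k hk (fun _ => Y) (fun _ => ν) (fun _ => S)
      (fun _ => hS) (K ω) ⟨h2, h3, h1.toMeasurePreserving⟩ h1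
    refine hi.abs_measureReal_prod_sub_le h2 h3 hm ?_ hA hE hF hF01 hsym hε
    refine le_trans (Nat.mul_le_mul_left m ?_) hmk
    -- The indices may repeat; only the bound `n` on their number matters.
    simpa using Finset.card_image_le (s := Finset.univ) (f := i)
  rw [hκl, hμB, ← integral_condExpKernel_real hm' hAE]
  set c := ρ.real A * (Measure.pi fun _ : Fin k => ν).real (π ⁻¹' B)
  have hc : c = ∫ _, c ∂l := by simp
  rw [hc, ← integral_sub (integrable_toReal_condExpKernel hAE) (integrable_const c)]
  refine abs_integral_le_integral_abs.trans ?_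
  refine (integral_mono_of_nonneg (ae_of_all _ fun _ => abs_nonneg _)
    (integrable_const (2 * ε + (√m)⁻¹)) hcomp).trans ?_
  simp

end JoiningPrimeness

theorem mainTheorem7 {𝕜 : Type*} [RCLike 𝕜] (n : ℕ) (hn : 1 ≤ n)
    {X : Type u} [MeasurableSpace X] [StandardBorelSpace X]
    (μ : Measure X) [IsProbabilityMeasure μ]
    (T : X ≃ᵐ X) (hT : MeasurePreserving T μ μ)
    (happrox : ∀ g : Lp 𝕜 2 μ,
      ∃ (k : ℕ → ℕ) (Y : ℕ → Type w) (_ : ∀ j, MeasurableSpace (Y j))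
        (_ : ∀ j, StandardBorelSpace (Y j)) (ν : ∀ j, Measure (Y j))
        (_ : ∀ j, IsProbabilityMeasure (ν j)) (S : ∀ j, Y j ≃ᵐ Y j)
        (π : ∀ j, (Fin (k j) → Y j) → X)
        (hπ : ∀ j, IsFactorMap (Pi.map fun _ : Fin (k j) => S j)
          (Measure.pi fun _ : Fin (k j) => ν j) T μ (π j)),
        Tendsto k atTop atTop ∧
        (∀ j, IsWeaklyMixing (S j) (ν j)) ∧
        (fun j => distSymmetric (Lp.compMeasurePreserving (π j) (hπ j).measurePreserving g))
          =o[atTop] fun j => (k j : ℝ) ^ (-((n : ℝ) / 2)))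
    {Z : Type v} [MeasurableSpace Z] [StandardBorelSpace Z]
    (ρ : Measure Z) [IsProbabilityMeasure ρ]
    (R : Z ≃ᵐ Z) (hR : JP.{v, w} n R ρ) :
    AreDisjoint T μ R ρ := by
  have hprod : IsJoining T μ R ρ (μ.prod ρ) :=
    ⟨Measure.fst_prod, Measure.snd_prod, hT.prod hR.ergodic.toMeasurePreserving⟩
  refine Set.eq_singleton_iff_unique_mem.2 ⟨hprod, fun κ hκ => ?_⟩
  have hκ : IsJoining T μ R ρ κ := hκ
  have : IsProbabilityMeasure κ := isProbabilityMeasure_of_map_fst hκ.map_fst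
  refine Measure.ext_prod fun {B A} hB hA => ?_
  have hbound : ∀ m : ℕ, m ≠ 0 →
      |κ.real (B ×ˢ A) - ρ.real A * μ.real B| ≤ 2 * (m : ℝ)⁻¹ + (√m)⁻¹ := by
    intro m hm
    obtain ⟨k, Y, _, _, ν, _, S, π, hπ, hk, hS, hdist⟩ :=
      happrox (indicatorConstLp 2 hB (measure_ne_top μ B) (1 : 𝕜))
    have hmpos : (0 : ℝ) < (m : ℝ)⁻¹ := by positivity
    -- The index `j` makes the distance less than 1/m, allows JP(n) to be applied, and leaves room
    -- for `m` disjoint blocks of `n` coordinates. The constant 1/(2m) makes the inequality strict,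
    -- as k_j^{-n/2} is at most 1.
    obtain ⟨j, hj1, hj2, hj3⟩ := ((hdist.def (half_pos hmpos)).and
      ((hk.eventually_ge_atTop (n + 1)).and (hk.eventually_ge_atTop (m * n)))).exists
    have hk1 : (1 : ℝ) ≤ k j := by exact_mod_cast (Nat.le_add_left 1 n).trans hj2
    have hlt : distSymmetric (Lp.compMeasurePreserving (π j) (hπ j).measurePreserving
        (indicatorConstLp 2 hB (measure_ne_top μ B) (1 : 𝕜))) < (m : ℝ)⁻¹ := by
      refine (le_abs_self _).trans_lt (hj1.trans_lt ?_)
      rw [Real.norm_eq_abs, abs_of_nonneg (by positivity)]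
      have h1 : (k j : ℝ) ^ (-((n : ℝ) / 2)) ≤ 1 :=
        Real.rpow_le_one_of_one_le_of_nonpos hk1 (by simp; positivity)
      nlinarith
    obtain ⟨F, hF, hF01, hsym, hε⟩ :=
      exists_symmetric_of_distSymmetric_lt (hπ j).measurePreserving hB hlt
    exact hR.abs_measureReal_joining_sub_le hT hj2 (hS j) (hπ j) hm hj3 hκ hA hB hF hF01 hsym hε
  have hlim : Tendsto (fun m : ℕ => 2 * (m : ℝ)⁻¹ + (√m)⁻¹) atTop (𝓝 (2 * 0 + 0)) :=
    (tendsto_inv_atTop_nhds_zero_nat.const_mul 2).add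
      (Real.tendsto_sqrt_atTop.comp tendsto_natCast_atTop_atTop).inv_tendsto_atTop
  have hzero : |κ.real (B ×ˢ A) - ρ.real A * μ.real B| ≤ 2 * 0 + 0 :=
    ge_of_tendsto hlim ((eventually_ne_atTop 0).mono hbound)
  have heq : κ.real (B ×ˢ A) = μ.real B * ρ.real A := by
    have h1 := abs_nonpos_iff.1 (hzero.trans (by norm_num))
    linarith
  rw [Measure.prod_prod, ← ENNReal.toReal_eq_toReal_iff' (measure_ne_top _ _)
    (ENNReal.mul_ne_top (measure_ne_top _ _) (measure_ne_top _ _)), ENNReal.toReal_mul]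
  exact heq
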